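/- Let $k$ be an algebraically closed field of characteristic $0$, and let $(R,\mathfrak m_R)$ be a one-dimensional complete Noetherian local domain which is a $k$-algebra with residue field $k$. Let $K$ be the fraction field of $R$, let $\overline R$ be the integral closure of $R$ in $K$, and let $\mathfrak C_R = R:_K\overline R$ be the conductor. Assume $\mathfrak C_R\subseteq \mathfrak m_R^2$. Let $x_1\in\mathfrak m_R$ generate a reduction of $\mathfrak m_R$, i.e. $x_1\mathfrak m_R^{n}=\mathfrak m_R^{n+1}$ for some $n\ge 0$ (equivalently, $x_1$ has minimal order among the elements of $\mathfrak m_R$ with respect to the valuation of $\overline R\cong k[[t]]$), and put $$S=R\left[\tfrac{\mathfrak C_R}{x_1}\right]=R\left[\tfrac{c}{x_1} : c\in\mathfrak C_R\right]\subseteq K .$$ Let $\omega_R\subseteq R$ be a canonical ideal of $R$, i.e. an ideal that is a canonical module of $R$ (a maximal Cohen–Macaulay module of type one and finite injective dimension), and let $\overline{\mathfrak m_R\omega_R}$ denote the integral closure in $R$ of the ideal $\mathfrak m_R\omega_R$. Then: 1. $S$ is a Cohen–Macaulay local ring, $\omega_R\cap\overline{\mathfrak m_R\omega_R}$ is an $S$-submodule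 of $K$, and it is a canonical module of $S$. 2. The reduced type $s=\dim_k \dfrac{(\mathfrak C_R,x_1)}{(x_1)}$ of $R$ satisfies $$s=\mu_R\left(\frac{\omega_R}{\omega_R\cap\overline{\mathfrak m_R\omega_R}}\right),$$ where $\mu_R(M)$ denotes the minimal number of generators of an $R$-module $M$. -/

import Mathlib

open Polynomial IsLocalRing CategoryTheory

universe u v

/-- `r` is integral over the ideal `I`: it satisfies an equation
`r ^ n + a₁ * r ^ (n - 1) + ⋯ + aₙ = 0` with `n ≥ 1` and `aᵢ ∈ I ^ i`. -/
def IsIntegralOverIdeal {R : Type u} [CommRing R] (I : Ideal R) (r : R) : Prop :=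
  ∃ n : ℕ, 0 < n ∧ ∃ a : ℕ → R, (∀ i, a i ∈ I ^ i) ∧
    r ^ n + ∑ i ∈ Finset.Icc 1 n, a i * r ^ (n - i) = 0

theorem isIntegralOverIdeal_iff_rees {R : Type u} [CommRing R] (I : Ideal R) (r : R) :
    IsIntegralOverIdeal I r ↔ IsIntegral (reesAlgebra I) (monomial 1 r : R[X]) := by
  constructor
  · rintro ⟨n, hn, a, ha, h⟩
    let b : ℕ → reesAlgebra I := fun i => ⟨monomial i (a i), reesAlgebra.monomial_mem.2 (ha i)⟩
    refine ⟨X ^ n + ∑ i ∈ Finset.Icc 1 n, C (b i) * X ^ (n - i), ?_, ?_⟩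
    · apply monic_X_pow_add
      refine (degree_sum_le _ _).trans_lt ?_
      rw [Finset.sup_lt_iff (by exact WithBot.bot_lt_coe n)]
      intro i hi
      refine (degree_C_mul_X_pow_le _ _).trans_lt ?_
      rw [Finset.mem_Icc] at hi
      exact_mod_cast (by omega : n - i < n)
    · rw [eval₂_add, eval₂_finsetSum, eval₂_X_pow]
      have key : ∀ i ∈ Finset.Icc 1 n,
          eval₂ (algebraMap (reesAlgebra I) R[X]) (monomial 1 r) (C (b i) * X ^ (n - i)) =
            monomial n (a i * r ^ (n - i)) := by
        intro i hi
        rw [Finset.mem_Icc] at hi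
        rw [eval₂_mul, eval₂_C, eval₂_X_pow, monomial_pow]
        change monomial i (a i) * _ = _
        rw [monomial_mul_monomial]
        have e : i + 1 * (n - i) = n := by omega
        rw [e]
      rw [Finset.sum_congr rfl key, monomial_pow, one_mul, ← map_sum, ← map_add, h, map_zero]
  · rintro ⟨p, hp, h⟩
    rcases subsingleton_or_nontrivial R with hR | hR
    · exact ⟨1, one_pos, 0, fun i => Submodule.zero_mem _, Subsingleton.elim _ _⟩
    have hn : 0 < p.natDegree := by
      rcases Nat.eq_zero_or_pos p.natDegree with h0 | h0
      · rw [eq_one_of_monic_natDegree_zero hp h0, eval₂_one] at h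
        exact absurd h one_ne_zero
      · exact h0
    refine ⟨p.natDegree, hn, fun i => (p.coeff (p.natDegree - i) : R[X]).coeff i,
      fun i => (p.coeff (p.natDegree - i)).2 i, ?_⟩
    rw [eval₂_eq_sum_range, Finset.sum_range_succ] at h
    have h2 := congrArg (fun q : R[X] => q.coeff p.natDegree) h
    simp only [hp.coeff_natDegree, map_one, one_mul, coeff_add, finsetSum_coeff, coeff_zero,
      monomial_pow, coeff_monomial_same] at h2
    rw [add_comm, ← h2]
    congr 1
    refine Finset.sum_bij' (fun i _ => p.natDegree - i) (fun j _ => p.natDegree - j) ?_ ?_ ?_ ?_ ?_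
    · intro i hi
      rw [Finset.mem_Icc] at hi
      rw [Finset.mem_range]
      omega
    · intro j hj
      rw [Finset.mem_range] at hj
      rw [Finset.mem_Icc]
      omega
    · intro i hi
      rw [Finset.mem_Icc] at hi
      omega
    · intro j hj
      rw [Finset.mem_range] at hj
      omega
    · intro i hi
      rw [Finset.mem_Icc] at hi
      have e : p.natDegree = i + (p.natDegree - i) := by omega
      change _ = ((p.coeff (p.natDegree - i) : R[X]) * _).coeff p.natDegree
      rw [← mul_one (p.natDegree - i), ← C_mul_X_pow_eq_monomial] at *
      simp only [mul_one] at *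
      rw [← mul_assoc, coeff_mul_X_pow', if_pos (by omega), coeff_mul_C]
      congr 2
      omega

/-- The integral closure (in `R`) of an ideal `I` of `R`. -/
def idealIntegralClosure {R : Type u} [CommRing R] (I : Ideal R) : Ideal R where
  carrier := {r | IsIntegralOverIdeal I r}
  zero_mem' := ⟨1, one_pos, 0, fun _ => Submodule.zero_mem _, by simp⟩
  add_mem' {r s} hr hs := by
    rw [Set.mem_ofPred_eq, isIntegralOverIdeal_iff_rees] at *
    rw [map_add]
    exact hr.add hs
  smul_mem' c r hr := by
    rw [Set.mem_ofPred_eq, isIntegralOverIdeal_iff_rees] at *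
    have h : (monomial 1 (c • r) : R[X]) = algebraMap R R[X] c * monomial 1 r := by
      rw [algebraMap_eq, C_mul_monomial, smul_eq_mul]
    rw [h]
    exact (isIntegral_algebraMap (R := reesAlgebra I)
      (x := algebraMap R (reesAlgebra I) c)).mul hr

/-- `J` is a reduction of the ideal `I`. -/
def IsIdealReduction {R : Type u} [CommRing R] (J I : Ideal R) : Prop :=
  J ≤ I ∧ ∃ n : ℕ, J * I ^ n = I ^ (n + 1)

/-- A maximal Cohen-Macaulay module over a local ring: a finitely generated module having a
regular sequence of length `dim R` inside the maximal ideal. -/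
def IsMaximalCohenMacaulay (R : Type u) [CommRing R] [IsLocalRing R]
    (M : Type u) [AddCommGroup M] [Module R M] : Prop :=
  Module.Finite R M ∧ ∃ rs : List R, (∀ r ∈ rs, r ∈ maximalIdeal R) ∧
    RingTheory.Sequence.IsRegular M rs ∧ ringKrullDim R = (rs.length : ℕ)

/-- A canonical module of a Cohen-Macaulay local ring `R` with residue field `κ`: a maximal
Cohen-Macaulay module `M` of type one and of finite injective dimension. The type of `M` is the
`κ`-dimension of `Ext^d(κ, M)` with `d = dim R`, which is its length over `R`. -/
structure IsCanonicalModule (R : Type u) [CommRing R] [IsLocalRing R]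
    (M : Type u) [AddCommGroup M] [Module R M] : Prop where
  isNoetherianRing : IsNoetherianRing R
  isCohenMacaulay : IsMaximalCohenMacaulay R R
  isMaximalCohenMacaulay : IsMaximalCohenMacaulay R M
  type_eq_one : ∃ d : ℕ, ringKrullDim R = d ∧
    Module.length R
      (Abelian.Ext (ModuleCat.of R (ResidueField R)) (ModuleCat.of R M) d) = 1
  finite_injectiveDimension : ∃ n : ℕ, HasInjectiveDimensionLE (ModuleCat.of R M) n

/-- The conductor `R :_K R̄` of `R` in its integral closure `R̄` in the fraction field `K`,
as an ideal of `R`. -/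
def conductorIdeal (R : Type u) [CommRing R] (K : Type u) [Field K] [Algebra R K] : Ideal R :=
  ((1 : Submodule R K) / Subalgebra.toSubmodule (integralClosure R K)).comap
    (Algebra.linearMap R K)

/-- The ring `R[C / x]`, as a subring of the fraction field `K` of `R`, with `C` the conductor. -/
def conductorTransform (R : Type u) [CommRing R] (K : Type u) [Field K] [Algebra R K] (x : R) :
    Subalgebra R K :=
  Algebra.adjoin R {z : K | ∃ c ∈ conductorIdeal R K, z = algebraMap R K c / algebraMap R K x}

/-- The `k`-dimension of `(C, x) / (x)`, with `C` the conductor of `R`. -/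
noncomputable def reducedType (k : Type v) [Field k] (R : Type u) [CommRing R] [Algebra k R]
    (K : Type u) [Field K] [Algebra R K] (x : R) : Cardinal.{u} :=
  Module.rank k
    (↥(conductorIdeal R K ⊔ Ideal.span {x}) ⧸
      (Ideal.span {x}).submoduleOf (conductorIdeal R K ⊔ Ideal.span {x}))

/-- The minimal number of generators of a module. -/
noncomputable def minNumGenerators (R : Type u) [CommRing R] (M : Type u) [AddCommGroup M]
    [Module R M] : Cardinal.{u} :=
  (⊤ : Submodule R M).spanRank

/-
Fix a canonical fractional ideal `Ω`. Since `K ⧸ Ω` is injective, `I ↦ Ω / I` is a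
length-preserving duality of fractional ideals; as the conductor is `C = (Ω / Ω) / R̄ = Ω / (Ω R̄)`,
it sends `C` to `Ω R̄`. Because `x` generates a reduction of the maximal ideal `m`, we have
`m R̄ = x R̄` and `m C = x C`. Together with `C ⊆ m²` the latter gives `(x⁻¹ C)² ⊆ C`, so that
`S = R + x⁻¹ C` is finite and local. Its dual `Ω / S = Ω ∩ x Ω R̄ = Ω ∩ m Ω R̄` is `Ω` intersected
with the integral closure of `m Ω`, and it is canonical for `S` since it represents `Hom_R(S, Ω)`.
Dualizing `S ⧸ R ≅ (C, x) ⧸ (x)` yields a quotient of `Ω` of the same length. Both quotients are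
killed by `m`, so that these lengths count minimal generators.
-/

section ExtVanishing

open Abelian

theorem subsingleton_ext_X₁_of_shortExact {C : Type*} [Category C] [Abelian C] [HasExt C]
    {S : ShortComplex C} (hS : S.ShortExact) (Y : C) (n : ℕ)
    (h₂ : Subsingleton (Ext S.X₂ Y n)) (h₃ : Subsingleton (Ext S.X₃ Y (n + 1))) :
    Subsingleton (Ext S.X₁ Y n) := by
  refine subsingleton_of_forall_eq 0 fun e ↦ ?_
  obtain ⟨e', rfl⟩ :=
    Ext.contravariant_sequence_exact₁ hS Y e (add_comm 1 n) (Subsingleton.elim _ _)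
  rw [Subsingleton.elim e' 0, Ext.comp_zero]

theorem subsingleton_ext_X₂_of_shortExact {C : Type*} [Category C] [Abelian C] [HasExt C]
    {S : ShortComplex C} (hS : S.ShortExact) (Y : C) (n : ℕ)
    (h₁ : Subsingleton (Ext S.X₁ Y n)) (h₃ : Subsingleton (Ext S.X₃ Y n)) :
    Subsingleton (Ext S.X₂ Y n) := by
  refine subsingleton_of_forall_eq 0 fun e ↦ ?_
  obtain ⟨e', rfl⟩ := Ext.contravariant_sequence_exact₂ hS Y e (Subsingleton.elim _ _)
  rw [Subsingleton.elim e' 0, Ext.comp_zero]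

theorem subsingleton_ext_of_iso {C : Type*} [Category C] [Abelian C] [HasExt C] {X X' : C}
    (i : X ≅ X') (Y : C) (n : ℕ) (h : Subsingleton (Ext X' Y n)) : Subsingleton (Ext X Y n) := by
  refine subsingleton_of_forall_eq 0 fun e ↦ ?_
  rw [← Ext.mk₀_id_comp e, ← i.hom_inv_id, ← Ext.mk₀_comp_mk₀_assoc,
    Subsingleton.elim ((Ext.mk₀ i.inv).comp e (zero_add n)) 0, Ext.comp_zero]

variable {R : Type u} [CommRing R]

theorem shortExact_subtype_mkQ {M : Type u} [AddCommGroup M] [Module R M] (N : Submodule R M) :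
    (ModuleCat.shortComplexOfCompEqZero N.subtype N.mkQ
      (LinearMap.exact_subtype_mkQ N).linearMap_comp_eq_zero).ShortExact :=
  ModuleCat.shortComplex_shortExact _ (LinearMap.exact_subtype_mkQ N) N.subtype_injective
    N.mkQ_surjective

theorem baer_of_subsingleton_ext_one (Y : ModuleCat.{u} R)
    (h : ∀ I : Ideal R, Subsingleton (Ext (ModuleCat.of R (R ⧸ I)) Y 1)) : Module.Baer R Y := by
  intro I f
  have := h I
  obtain ⟨e, he⟩ := Ext.contravariant_sequence_exact₁ (shortExact_subtype_mkQ I) Y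
    (Ext.mk₀ (ModuleCat.ofHom f)) (add_zero 1) (Subsingleton.elim _ _)
  obtain ⟨g, rfl⟩ := (Ext.mk₀_bijective _ _).2 e
  rw [Ext.mk₀_comp_mk₀, (Ext.mk₀_bijective _ _).1.eq_iff] at he
  exact ⟨g.hom, fun r hr ↦ congrArg (fun φ ↦ φ.hom ⟨r, hr⟩) he⟩

theorem hasInjectiveDimensionLE_one_of_subsingleton_ext_two (Y : ModuleCat.{u} R)
    (h : ∀ I : Ideal R, Subsingleton (Ext (ModuleCat.of R (R ⧸ I)) Y 2)) :
    HasInjectiveDimensionLE Y 1 := by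
  obtain ⟨E, _, i, _⟩ := EnoughInjectives.presentation Y
  let S := ShortComplex.mk i (Limits.cokernel.π i) (Limits.cokernel.condition i)
  have hS : S.ShortExact := { exact := ShortComplex.exact_cokernel i }
  refine (hS.hasInjectiveDimensionLT_X₃_iff 0 ‹_›).mp (injective_iff_hasInjectiveDimensionLT_one.mp
    ((Module.injective_iff_injective_object R S.X₃).mp (Module.Baer.iff_injective.mp
    (baer_of_subsingleton_ext_one S.X₃ fun I ↦ subsingleton_of_forall_eq 0 fun e ↦ ?_))))
  have := h I
  have hE : Subsingleton (Ext (ModuleCat.of R (R ⧸ I)) S.X₂ 1) :=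
    Ext.subsingleton_of_injective _ E 0
  obtain ⟨e', rfl⟩ := Ext.covariant_sequence_exact₃ _ hS e rfl (Subsingleton.elim _ _)
  rw [Subsingleton.elim e' 0, Ext.zero_comp]

theorem subsingleton_ext_of_forall_quotient_prime [IsNoetherianRing R] (Y : ModuleCat.{u} R)
    (n : ℕ) (h : ∀ p : Ideal R, p.IsPrime → Subsingleton (Ext (ModuleCat.of R (R ⧸ p)) Y n))
    (M : Type u) [AddCommGroup M] [Module R M] [hM : Module.Finite R M] :
    Subsingleton (Ext (ModuleCat.of R M) Y n) := by
  induction hM using IsNoetherianRing.induction_on_isQuotientEquivQuotientPrime R with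
  | subsingleton N =>
    have := (ModuleCat.isZero_of_subsingleton (ModuleCat.of R N)).hasProjectiveDimensionLT_zero
    exact HasProjectiveDimensionLT.subsingleton _ 0 n n.zero_le Y
  | quotient N p φ => exact subsingleton_ext_of_iso φ.toModuleIso Y n (h p.1 p.2)
  | exact N₁ N₂ N₃ f g hf hg hfg h₁ h₃ =>
    exact subsingleton_ext_X₂_of_shortExact (ModuleCat.shortComplex_shortExact
      (ModuleCat.shortComplexOfCompEqZero f g hfg.linearMap_comp_eq_zero) hfg hf hg) Y n h₁ h₃

theorem hasProjectiveDimensionLE_one_quotient_span_singleton [IsDomain R] {x : R} (hx : x ≠ 0) :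
    HasProjectiveDimensionLE (ModuleCat.of R (R ⧸ Ideal.span {x})) 1 := by
  have hproj (N : Type u) [AddCommGroup N] [Module R N] [Module.Projective R N] :
      HasProjectiveDimensionLT (ModuleCat.of R N) 1 := inferInstance
  have : Module.Projective R (Ideal.span {x}) :=
    .of_equiv (LinearEquiv.toSpanNonzeroSingleton R R x hx)
  exact (shortExact_subtype_mkQ (Ideal.span {x})).hasProjectiveDimensionLT_X₃ 1
    (hproj _) (hasProjectiveDimensionLT_of_ge _ 1 2 one_le_two)

theorem maximalIdeal_mem_associatedPrimes_of_isTorsion [IsLocalRing R] [IsNoetherianRing R]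
    [Ring.DimensionLEOne R] {M : Type*} [AddCommGroup M] [Module R M] [Nontrivial M]
    (hM : Module.IsTorsion R M) : maximalIdeal R ∈ associatedPrimes R M := by
  obtain ⟨p, hp⟩ := associatedPrimes.nonempty R M
  obtain ⟨hpp, u, hu⟩ := isAssociatedPrime_iff.mp hp
  obtain ⟨a, ha⟩ := @hM u
  have hap : (a : R) ∈ p := by rw [hu, Submodule.mem_colon_singleton]; exact ha
  have hp0 : p ≠ ⊥ := fun h ↦ nonZeroDivisors.coe_ne_zero a (by rwa [h] at hap)
  rwa [← eq_maximalIdeal (Ring.DimensionLEOne.maximalOfPrime hp0 hpp)]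

theorem isTorsion_quotient_ideal_of_ne_bot [IsDomain R] {I : Ideal R} (hI : I ≠ ⊥) :
    Module.IsTorsion R (R ⧸ I) := fun {y} ↦ by
  obtain ⟨x, hxI, hx⟩ := Submodule.exists_mem_ne_zero_of_ne_bot hI
  obtain ⟨r, rfl⟩ := Ideal.Quotient.mk_surjective y
  exact ⟨⟨x, mem_nonZeroDivisors_of_ne_zero hx⟩,
    Ideal.Quotient.eq_zero_iff_mem.mpr (Ideal.mul_mem_right r _ hxI)⟩

variable [IsDomain R] [IsLocalRing R] [IsNoetherianRing R] [Ring.DimensionLEOne R]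

theorem exists_injective_residueField_quotient_span_singleton {x : R} (hx : x ≠ 0)
    (hxm : x ∈ maximalIdeal R) :
    ∃ f : (R ⧸ maximalIdeal R) →ₗ[R] R ⧸ Ideal.span {x}, Function.Injective f := by
  have : Nontrivial (R ⧸ Ideal.span {x}) := Ideal.Quotient.nontrivial_iff.mpr
    (ne_top_of_le_ne_top Ideal.IsPrime.ne_top' ((Ideal.span_singleton_le_iff_mem _).mpr hxm))
  exact ((isAssociatedPrime_iff_exists_injective_linearMap _ _).mp
    (maximalIdeal_mem_associatedPrimes_of_isTorsion (isTorsion_quotient_ideal_of_ne_bot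
      (Ideal.span_singleton_eq_bot.not.mpr hx)))).2

theorem subsingleton_ext_of_forall_subsingleton_ext_succ (hR : ¬ IsField R) (Y : ModuleCat.{u} R)
    {n : ℕ} (hn : 2 ≤ n)
    (h : ∀ (M : Type u) [AddCommGroup M] [Module R M] [Module.Finite R M],
      Subsingleton (Ext (ModuleCat.of R M) Y (n + 1)))
    (M : Type u) [AddCommGroup M] [Module R M] [Module.Finite R M] :
    Subsingleton (Ext (ModuleCat.of R M) Y n) := by
  refine subsingleton_ext_of_forall_quotient_prime Y n (fun p hp ↦ ?_) M
  obtain rfl | hp0 := eq_or_ne p ⊥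
  · have : Module.Projective R (R ⧸ (⊥ : Ideal R)) :=
      .of_equiv (Submodule.quotEquivOfEqBot (⊥ : Ideal R) rfl).symm
    exact HasProjectiveDimensionLT.subsingleton _ 1 n (by omega) Y
  rw [eq_maximalIdeal (Ring.DimensionLEOne.maximalOfPrime hp0 hp)]
  obtain ⟨x, hxm, hx⟩ := Submodule.exists_mem_ne_zero_of_ne_bot
    (isField_iff_maximalIdeal_eq.not.mp hR)
  obtain ⟨f, hf⟩ := exists_injective_residueField_quotient_span_singleton hx hxm
  have := hasProjectiveDimensionLE_one_quotient_span_singleton hx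
  exact subsingleton_ext_X₁_of_shortExact (ModuleCat.shortComplex_shortExact
    (ModuleCat.shortComplexOfCompEqZero f f.range.mkQ f.exact_map_mkQ_range.linearMap_comp_eq_zero)
    f.exact_map_mkQ_range hf (Submodule.mkQ_surjective _)) Y n
    (HasProjectiveDimensionLT.subsingleton _ 2 n hn Y) (h _)

theorem subsingleton_ext_of_hasInjectiveDimensionLE (hR : ¬ IsField R) (Y : ModuleCat.{u} R)
    (d : ℕ) [HasInjectiveDimensionLE Y d] {n : ℕ} (hn : 2 ≤ n)
    (M : Type u) [AddCommGroup M] [Module R M] [Module.Finite R M] :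
    Subsingleton (Ext (ModuleCat.of R M) Y n) := by
  obtain ⟨j, hj⟩ : ∃ j, d + 1 ≤ n + j := ⟨d + 1, by omega⟩
  induction j generalizing n M with
  | zero => exact HasInjectiveDimensionLT.subsingleton Y (d + 1) n hj _
  | succ j ih =>
    exact subsingleton_ext_of_forall_subsingleton_ext_succ hR Y hn
      (fun N _ _ _ ↦ ih (by omega) N (by omega)) M

theorem hasInjectiveDimensionLE_one_of_hasInjectiveDimensionLE (hR : ¬ IsField R)
    (Y : ModuleCat.{u} R) (d : ℕ) [HasInjectiveDimensionLE Y d] : HasInjectiveDimensionLE Y 1 :=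
  hasInjectiveDimensionLE_one_of_subsingleton_ext_two Y fun _ ↦
    subsingleton_ext_of_hasInjectiveDimensionLE hR Y d le_rfl _

end ExtVanishing

section Duality

theorem exists_linearMap_apply_ne_zero_of_baer {R E M : Type*} [CommRing R] [IsLocalRing R]
    [AddCommGroup E] [Module R E] [AddCommGroup M] [Module R M] (hE : Module.Baer R E)
    {ι : (R ⧸ maximalIdeal R) →ₗ[R] E} (hι : Function.Injective ι) {m : M} (hm : m ≠ 0) :
    ∃ f : M →ₗ[R] E, f m ≠ 0 := by
  have hle : Ideal.torsionOf R M m ≤ maximalIdeal R := le_maximalIdeal fun h ↦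
    hm ((Ideal.torsionOf_eq_top_iff R m).mp h)
  let e := Ideal.quotTorsionOfEquivSpanSingleton R M m
  obtain ⟨f, hf⟩ := hE.extension_property (R ∙ m).subtype (R ∙ m).subtype_injective
    (ι ∘ₗ Submodule.factor hle ∘ₗ e.symm.toLinearMap)
  have he : e.symm ⟨m, Submodule.mem_span_singleton_self m⟩ = Ideal.Quotient.mk _ 1 :=
    e.symm_apply_eq.mpr (Subtype.ext (one_smul R m).symm)
  have hfm : f m = ι (Ideal.Quotient.mk _ 1) := by
    simpa [he] using LinearMap.congr_fun hf ⟨m, Submodule.mem_span_singleton_self m⟩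
  refine ⟨f, ?_⟩
  rw [hfm, map_one, ne_eq, map_eq_zero_iff ι hι]
  exact one_ne_zero

theorem antitone_div {R A : Type*} [CommSemiring R] [CommSemiring A] [Algebra R A]
    (Ω : Submodule R A) : Antitone fun I : Submodule R A ↦ Ω / I := fun _ _ h _ hz ↦
  Submodule.mem_div_iff_forall_mul_mem.mpr fun y hy ↦
    Submodule.mem_div_iff_forall_mul_mem.mp hz y (h hy)

theorem fg_div_of_ne_bot {R K : Type*} [CommRing R] [IsNoetherianRing R] [Field K] [Algebra R K]
    {Ω I : Submodule R K} (hΩ : Ω.FG) (hI : I ≠ ⊥) : (Ω / I).FG := by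
  obtain ⟨i, hi, hi0⟩ := Submodule.exists_mem_ne_zero_of_ne_bot hI
  refine Submodule.FG.of_le (hΩ.map (LinearMap.mulLeft R i⁻¹)) fun z hz ↦
    ⟨z * i, Submodule.mem_div_iff_forall_mul_mem.mp hz i hi, ?_⟩
  rw [LinearMap.mulLeft_apply, mul_comm, mul_assoc, mul_inv_cancel₀ hi0, mul_one]

/-- The submodules of `J ⧸ I` correspond to the submodules between `I` and `J`. -/
def submoduleQuotientOrderIso {R M : Type*} [Ring R] [AddCommGroup M] [Module R M]
    {I J : Submodule R M} (h : I ≤ J) : Submodule R (J ⧸ I.submoduleOf J) ≃o Set.Icc I J where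
  toFun N := ⟨(N.comap (I.submoduleOf J).mkQ).map J.subtype, by
    refine (inf_eq_right.mpr h).symm.trans_le ?_
    rw [← Submodule.map_comap_subtype]
    exact Submodule.map_mono (Submodule.le_comap_mkQ _ N), Submodule.map_subtype_le _ _⟩
  invFun X := (X.1.comap J.subtype).map (I.submoduleOf J).mkQ
  left_inv N := by
    dsimp only
    rw [Submodule.comap_map_eq_of_injective J.subtype_injective,
      Submodule.map_comap_eq_of_surjective (Submodule.mkQ_surjective _)]
  right_inv X := by
    ext1
    dsimp only
    rw [Submodule.comap_map_mkQ, sup_eq_right.mpr (Submodule.comap_mono X.2.1),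
      Submodule.map_comap_subtype, inf_eq_right.mpr X.2.2]
  map_rel_iff' {N N'} := by
    change Submodule.map _ _ ≤ Submodule.map _ _ ↔ _
    rw [Submodule.map_le_map_iff_of_injective J.subtype_injective,
      Submodule.comap_le_comap_iff_of_surjective (Submodule.mkQ_surjective _)]

theorem length_quotient_submoduleOf {R M : Type*} [Ring R] [AddCommGroup M] [Module R M]
    {I J : Submodule R M} (h : I ≤ J) :
    (Module.length R (J ⧸ I.submoduleOf J) : WithBot ℕ∞) = Order.krullDim (Set.Icc I J) := by
  rw [Module.coe_length, Order.krullDim_eq_of_orderIso (submoduleQuotientOrderIso h)]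

/-- A canonical fractional ideal of a one-dimensional domain `R` with fraction field `K`. As `K` is
an injective `R`-module, the injectivity of `K ⧸ Ω` says that `0 → Ω → K → K ⧸ Ω → 0` is an
injective resolution; `Ω ≠ ⊤` excludes the case where `R` is a field. -/
structure IsCanonicalFractionalIdeal {R K : Type*} [CommRing R] [Field K] [Algebra R K]
    (Ω : Submodule R K) : Prop where
  fg : Ω.FG
  ne_bot : Ω ≠ ⊥
  ne_top : Ω ≠ ⊤
  baer_quotient : Module.Baer R (K ⧸ Ω)

variable {R : Type*} [CommRing R] [IsDomain R] {K : Type*} [Field K] [Algebra R K]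
  [IsFractionRing R K]

theorem baer_fractionRing (R K : Type*) [CommRing R] [IsDomain R] [Field K] [Algebra R K]
    [IsFractionRing R K] : Module.Baer R K := by
  intro I f
  obtain rfl | hI := eq_or_ne I ⊥
  · exact ⟨0, fun y hy ↦ by
      rw [LinearMap.zero_apply, Subsingleton.elim (⟨y, hy⟩ : (⊥ : Ideal R)) 0, map_zero]⟩
  obtain ⟨a, ha, ha0⟩ := Submodule.exists_mem_ne_zero_of_ne_bot hI
  have ha' : algebraMap R K a ≠ 0 := by simpa using ha0
  refine ⟨LinearMap.toSpanSingleton R K (f ⟨a, ha⟩ / algebraMap R K a), fun y hy ↦ ?_⟩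
  have h : y • f ⟨a, ha⟩ = a • f ⟨y, hy⟩ := by
    rw [← map_smul, ← map_smul]
    exact congrArg f (Subtype.ext (mul_comm y a))
  rw [LinearMap.toSpanSingleton_apply, Algebra.smul_def, ← mul_div_assoc, ← Algebra.smul_def, h,
    Algebra.smul_def, mul_div_cancel_left₀ _ ha']

theorem isTorsion_fractionRing_quotient_of_ne_bot {Ω : Submodule R K} (hΩ : Ω ≠ ⊥) :
    Module.IsTorsion R (K ⧸ Ω) := by
  intro u
  obtain ⟨u, rfl⟩ := Ω.mkQ_surjective u
  obtain ⟨w, hw, hw0⟩ := Submodule.exists_mem_ne_zero_of_ne_bot hΩ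
  obtain ⟨a, b, hb, hab⟩ := IsFractionRing.div_surjective (A := R) (u / w)
  have hb0 : algebraMap R K b ≠ 0 := IsFractionRing.to_map_ne_zero_of_mem_nonZeroDivisors hb
  refine ⟨⟨b, hb⟩, (Submodule.Quotient.mk_eq_zero Ω).mpr ?_⟩
  have hbu : b • u = a • w := by
    rw [Algebra.smul_def, Algebra.smul_def, mul_comm]
    exact ((div_eq_div_iff hb0 hw0).mp hab).symm
  change b • u ∈ Ω
  exact hbu ▸ Ω.smul_mem a hw

theorem exists_eq_mkQ_mul_of_fg {Ω J : Submodule R K} (hJ : J.FG) (f : K →ₗ[R] K ⧸ Ω) :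
    ∃ y : K, ∀ j ∈ J, f j = Ω.mkQ (y * j) := by
  obtain ⟨d, hd, hdJ⟩ := FractionalIdeal.isFractional_of_fg (S := nonZeroDivisors R) hJ
  have hd0 : algebraMap R K d ≠ 0 := IsFractionRing.to_map_ne_zero_of_mem_nonZeroDivisors hd
  obtain ⟨z, hz⟩ := Ω.mkQ_surjective (f (algebraMap R K d)⁻¹)
  refine ⟨z * algebraMap R K d, fun j hj ↦ ?_⟩
  obtain ⟨r, hr⟩ := hdJ j hj
  rw [Algebra.smul_def] at hr
  have hj : j = r • (algebraMap R K d)⁻¹ := by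
    rw [Algebra.smul_def, hr, mul_comm, inv_mul_cancel_left₀ hd0]
  rw [mul_assoc, ← hr, mul_comm, ← Algebra.smul_def, map_smul, hz, ← map_smul, ← hj]

theorem ne_top_of_fg_of_not_isField (hR : ¬ IsField R) {Ω : Submodule R K} (hΩ : Ω.FG) :
    Ω ≠ ⊤ := by
  rintro rfl
  obtain ⟨d, hd, hdJ⟩ := FractionalIdeal.isFractional_of_fg (S := nonZeroDivisors R) hΩ
  have hd0 : algebraMap R K d ≠ 0 := IsFractionRing.to_map_ne_zero_of_mem_nonZeroDivisors hd
  have hsurj : Function.Surjective (algebraMap R K) := fun z ↦ by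
    obtain ⟨r, hr⟩ := hdJ (z / algebraMap R K d) trivial
    exact ⟨r, by rw [hr, Algebra.smul_def, mul_div_cancel₀ _ hd0]⟩
  exact hR ((RingEquiv.ofBijective _ ⟨IsFractionRing.injective R K, hsurj⟩).toMulEquiv.isField
    (Field.toIsField K))

theorem div_ne_bot_of_fg {Ω J : Submodule R K} (hΩ : Ω ≠ ⊥) (hJ : J.FG) : Ω / J ≠ ⊥ := by
  obtain ⟨d, hd, hdJ⟩ := FractionalIdeal.isFractional_of_fg (S := nonZeroDivisors R) hJ
  obtain ⟨w, hw, hw0⟩ := Submodule.exists_mem_ne_zero_of_ne_bot hΩ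
  have hd0 : algebraMap R K d ≠ 0 := IsFractionRing.to_map_ne_zero_of_mem_nonZeroDivisors hd
  refine (Submodule.ne_bot_iff _).mpr ⟨algebraMap R K d * w, ?_, mul_ne_zero hd0 hw0⟩
  rw [Submodule.mem_div_iff_forall_mul_mem]
  intro j hj
  obtain ⟨r, hr⟩ := hdJ j hj
  rw [mul_right_comm, ← Algebra.smul_def, ← hr, ← Algebra.smul_def]
  exact Ω.smul_mem r hw

namespace IsCanonicalFractionalIdeal

variable [IsLocalRing R] [IsNoetherianRing R] [Ring.DimensionLEOne R] {Ω : Submodule R K}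

theorem exists_injective_residueField (hΩ : IsCanonicalFractionalIdeal Ω) :
    ∃ ι : (R ⧸ maximalIdeal R) →ₗ[R] K ⧸ Ω, Function.Injective ι :=
  have : Nontrivial (K ⧸ Ω) := Submodule.Quotient.nontrivial_iff.mpr hΩ.ne_top
  ((isAssociatedPrime_iff_exists_injective_linearMap _ _).mp
    (maximalIdeal_mem_associatedPrimes_of_isTorsion
      (isTorsion_fractionRing_quotient_of_ne_bot hΩ.ne_bot))).2

theorem div_div_eq_self (hΩ : IsCanonicalFractionalIdeal Ω) {I : Submodule R K} (hI : I.FG) :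
    Ω / (Ω / I) = I := by
  refine le_antisymm (fun z hz ↦ ?_) fun z hz ↦
    Submodule.mem_div_iff_forall_mul_mem.mpr fun y hy ↦ ?_
  · by_contra hzI
    obtain ⟨ι, hι⟩ := hΩ.exists_injective_residueField
    obtain ⟨f, hf⟩ := exists_linearMap_apply_ne_zero_of_baer hΩ.baer_quotient hι
      (m := I.mkQ z) (by simpa using hzI)
    obtain ⟨y, hy⟩ := exists_eq_mkQ_mul_of_fg (hI.sup (Submodule.fg_span_singleton z))
      (f ∘ₗ I.mkQ)
    have hyI : y ∈ Ω / I := Submodule.mem_div_iff_forall_mul_mem.mpr fun i hi ↦ by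
      have hi0 : I.mkQ i = 0 := (Submodule.Quotient.mk_eq_zero I).mpr hi
      rw [← Submodule.Quotient.mk_eq_zero, ← Submodule.mkQ_apply,
        ← hy i (Submodule.mem_sup_left hi), LinearMap.comp_apply, hi0, map_zero]
    have hyz := hy z (Submodule.mem_sup_right (Submodule.mem_span_singleton_self z))
    refine hf (hyz.trans ((Submodule.Quotient.mk_eq_zero Ω).mpr ?_))
    exact mul_comm z y ▸ Submodule.mem_div_iff_forall_mul_mem.mp hz y hyI
  · exact mul_comm y z ▸ Submodule.mem_div_iff_forall_mul_mem.mp hy z hz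

/-- Duality with respect to a canonical fractional ideal `Ω`, on the interval from `I` to `J`. -/
def divOrderIso (hΩ : IsCanonicalFractionalIdeal Ω) {I J : Submodule R K} (hI : I ≠ ⊥)
    (hJ : J.FG) : Set.Icc I J ≃o (Set.Icc (Ω / J) (Ω / I))ᵒᵈ where
  toFun X := OrderDual.toDual ⟨Ω / X.1, antitone_div Ω X.2.2, antitone_div Ω X.2.1⟩
  invFun Y := ⟨Ω / (OrderDual.ofDual Y).1,
    fun i hi ↦ Submodule.mem_div_iff_forall_mul_mem.mpr fun y hy ↦ mul_comm y i ▸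
      Submodule.mem_div_iff_forall_mul_mem.mp ((OrderDual.ofDual Y).2.2 hy) i hi,
    (antitone_div Ω (OrderDual.ofDual Y).2.1).trans_eq (hΩ.div_div_eq_self hJ)⟩
  left_inv X := Subtype.ext (hΩ.div_div_eq_self (hJ.of_le X.2.2))
  right_inv Y := OrderDual.ofDual.injective (Subtype.ext (hΩ.div_div_eq_self
    ((fg_div_of_ne_bot hΩ.fg hI).of_le (OrderDual.ofDual Y).2.2)))
  map_rel_iff' {X Y} := by
    refine ⟨fun h ↦ ?_, fun h ↦ antitone_div Ω h⟩
    have h' : Ω / (Ω / X.1) ≤ Ω / (Ω / Y.1) := antitone_div Ω h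
    rwa [hΩ.div_div_eq_self (hJ.of_le X.2.2), hΩ.div_div_eq_self (hJ.of_le Y.2.2)] at h'

theorem length_quotient_eq_length_div_quotient_div (hΩ : IsCanonicalFractionalIdeal Ω)
    {I J : Submodule R K} (hIJ : I ≤ J) (hI : I ≠ ⊥) (hJ : J.FG) :
    Module.length R (J ⧸ I.submoduleOf J) =
      Module.length R (↥(Ω / I) ⧸ (Ω / J).submoduleOf (Ω / I)) := by
  apply WithBot.coe_injective
  rw [length_quotient_submoduleOf hIJ, length_quotient_submoduleOf (antitone_div Ω hIJ),
    Order.krullDim_eq_of_orderIso (hΩ.divOrderIso hI hJ), Order.krullDim_orderDual]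

theorem exists_forall_eq_smul (hΩ : IsCanonicalFractionalIdeal Ω)
    (φ : (K ⧸ Ω) →ₗ[R] K ⧸ Ω) (v : K ⧸ Ω) : ∃ r : R, φ v = r • v := by
  obtain ⟨v, rfl⟩ := Ω.mkQ_surjective v
  obtain ⟨y, hy⟩ := exists_eq_mkQ_mul_of_fg (hΩ.fg.sup (Submodule.fg_span_singleton v))
    (φ ∘ₗ Ω.mkQ)
  have hyΩ : y ∈ Ω / (Ω / (1 : Submodule R K)) := by
    refine Submodule.mem_div_iff_forall_mul_mem.mpr fun w hw ↦ ?_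
    have hwΩ : w ∈ Ω := by
      simpa using Submodule.mem_div_iff_forall_mul_mem.mp hw 1 (Submodule.one_le.mp le_rfl)
    have hw0 : Ω.mkQ w = 0 := (Submodule.Quotient.mk_eq_zero Ω).mpr hwΩ
    rw [← Submodule.Quotient.mk_eq_zero, ← Submodule.mkQ_apply,
      ← hy w (Submodule.mem_sup_left hwΩ), LinearMap.comp_apply, hw0, map_zero]
  rw [hΩ.div_div_eq_self (Submodule.one_eq_span (R := R) (A := K) ▸
    Submodule.fg_span_singleton 1)] at hyΩ
  obtain ⟨r, rfl⟩ := Submodule.mem_one.mp hyΩ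
  refine ⟨r, ?_⟩
  rw [← map_smul, Algebra.smul_def]
  exact hy v (Submodule.mem_sup_right (Submodule.mem_span_singleton_self v))

end IsCanonicalFractionalIdeal

end Duality

theorem dimensionLEOne_of_ringKrullDim_eq_one {R : Type*} [CommRing R] [IsDomain R]
    (h : ringKrullDim R = 1) : Ring.DimensionLEOne R where
  maximalOfPrime {p} hp0 hp :=
    Ring.krullDimLE_one_iff_of_noZeroDivisors.mp (Ring.krullDimLE_iff.mpr h.le) p hp0 hp

theorem not_isField_of_ringKrullDim_eq_one {R : Type*} [CommRing R] (h : ringKrullDim R = 1) :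
    ¬ IsField R := fun hR ↦
  zero_ne_one ((ringKrullDim_eq_zero_of_isField hR).symm.trans h)

theorem ringKrullDim_eq_one_of_not_isField {R : Type*} [CommRing R] [IsDomain R]
    [Ring.DimensionLEOne R] (hR : ¬ IsField R) : ringKrullDim R = 1 := by
  have h0 : ¬ ringKrullDim R ≤ 0 := fun h ↦ hR <|
    have : Ring.KrullDimLE 0 R := Ring.krullDimLE_iff.mpr h
    Ring.KrullDimLE.isField_of_isDomain
  exact le_antisymm (Ring.krullDimLE_iff.mp (Ring.krullDimLE_one_iff_of_noZeroDivisors.mpr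
    fun I hI hIp ↦ Ring.DimensionLEOne.maximalOfPrime hI hIp))
    ((WithBot.one_le_iff_pos _).mpr (not_le.mp h0))

theorem subsingleton_linearMap_of_isTorsion {R M N : Type*} [CommRing R] [AddCommGroup M]
    [Module R M] [AddCommGroup N] [Module R N] [Module.IsTorsionFree R N]
    (hM : Module.IsTorsion R M) : Subsingleton (M →ₗ[R] N) := by
  refine subsingleton_of_forall_eq 0 fun f ↦ LinearMap.ext fun m ↦ ?_
  obtain ⟨a, ha⟩ := @hM m
  have hfm : a • f m = a • (0 : N) := by
    rw [smul_zero, ← map_zero f, ← ha]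
    exact (map_smul f (a : R) m).symm
  exact Module.IsTorsionFree.isSMulRegular (isRegular_iff_mem_nonZeroDivisors.mpr a.2) hfm

theorem bijective_postcomp_extClass {C : Type*} [Category* C] [Abelian C] [HasExt C]
    {S : ShortComplex C} (hS : S.ShortExact) [Injective S.X₂] (X : C)
    [Subsingleton (X ⟶ S.X₂)] :
    Function.Bijective (hS.extClass.postcomp X (zero_add 1)) := by
  have : Subsingleton (Abelian.Ext X S.X₂ 0) := Abelian.Ext.homEquiv₀.subsingleton
  refine ⟨(injective_iff_map_eq_zero _).mpr fun e he ↦ ?_, fun e ↦ ?_⟩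
  · obtain ⟨g, rfl⟩ := Abelian.Ext.covariant_sequence_exact₃ _ hS e (zero_add 1) he
    rw [Subsingleton.elim g 0, Abelian.Ext.zero_comp]
  · exact Abelian.Ext.covariant_sequence_exact₁ _ hS e (Abelian.Ext.eq_zero_of_injective _)
      (zero_add 1)

theorem injective_moduleCat_of_baer {R M : Type u} [CommRing R] [AddCommGroup M] [Module R M]
    (h : Module.Baer R M) : Injective (ModuleCat.of R M) :=
  (Module.injective_iff_injective_object R M).mp h.injective

theorem isMaximalCohenMacaulay_of_isTorsionFree {R : Type u} [CommRing R] [IsDomain R]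
    [IsLocalRing R] [IsNoetherianRing R] (hR : ringKrullDim R = 1) (M : Type u) [AddCommGroup M]
    [Module R M] [Module.IsTorsionFree R M] [Nontrivial M] [Module.Finite R M] :
    IsMaximalCohenMacaulay R M := by
  obtain ⟨x, hxm, hx⟩ := Submodule.exists_mem_ne_zero_of_ne_bot
    (isField_iff_maximalIdeal_eq.not.mp (not_isField_of_ringKrullDim_eq_one hR))
  refine ⟨inferInstance, [x], by simpa using hxm, ?_, by simpa using hR⟩
  rw [isRegular_iff_isWeaklyRegular_of_subset_maximalIdeal (by simpa using hxm),
    RingTheory.Sequence.isWeaklyRegular_singleton_iff]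
  exact smul_right_injective M hx

namespace IsCanonicalFractionalIdeal

variable {R : Type u} [CommRing R] [IsDomain R] {K : Type u} [Field K] [Algebra R K]
  [IsFractionRing R K] {Ω : Submodule R K}

theorem hasInjectiveDimensionLE_one (hΩ : IsCanonicalFractionalIdeal Ω) :
    HasInjectiveDimensionLE (ModuleCat.of R Ω) 1 :=
  have : Injective (ModuleCat.of R K) := injective_moduleCat_of_baer (baer_fractionRing R K)
  ((shortExact_subtype_mkQ Ω).hasInjectiveDimensionLT_X₃_iff 0 this).mp
    (injective_iff_hasInjectiveDimensionLT_one.mp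
      (injective_moduleCat_of_baer hΩ.baer_quotient))

variable [IsLocalRing R] [IsNoetherianRing R] [Ring.DimensionLEOne R]

theorem isSimpleModule_residueField_linearMap (hΩ : IsCanonicalFractionalIdeal Ω) :
    IsSimpleModule R (ResidueField R →ₗ[R] K ⧸ Ω) := by
  have : IsSimpleModule R (ResidueField R) :=
    isSimpleModule_iff_isCoatom.mpr (maximalIdeal.isMaximal R).out
  obtain ⟨ι, hι⟩ := hΩ.exists_injective_residueField
  refine isSimpleModule_iff_toSpanSingleton_surjective.mpr
    ⟨⟨ι, 0, fun h ↦ one_ne_zero (hι ((LinearMap.congr_fun h 1).trans ι.map_zero.symm))⟩,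
      fun g hg g' ↦ ?_⟩
  obtain ⟨φ, hφ⟩ := hΩ.baer_quotient.extension_property g
    (g.injective_or_eq_zero.resolve_right hg) g'
  obtain ⟨r, hr⟩ := hΩ.exists_forall_eq_smul φ (g 1)
  refine ⟨r, LinearMap.ext fun z ↦ ?_⟩
  obtain ⟨s, rfl⟩ := residue_surjective z
  have hs (f : ResidueField R →ₗ[R] K ⧸ Ω) : f (residue R s) = s • f 1 := by
    rw [← map_smul, Algebra.smul_def, mul_one]
    rfl
  rw [LinearMap.toSpanSingleton_apply, LinearMap.smul_apply, hs, hs, ← hφ, LinearMap.comp_apply,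
    hr, smul_comm]

theorem length_ext_one_residueField (hΩ : IsCanonicalFractionalIdeal Ω) (hR : ¬ IsField R) :
    Module.length R
      (Abelian.Ext (ModuleCat.of R (ResidueField R)) (ModuleCat.of R Ω) 1) = 1 := by
  have hS := shortExact_subtype_mkQ Ω
  have : Injective (ModuleCat.of R K) := injective_moduleCat_of_baer (baer_fractionRing R K)
  have : Subsingleton (ResidueField R →ₗ[R] K) := subsingleton_linearMap_of_isTorsion
    (isTorsion_quotient_ideal_of_ne_bot (isField_iff_maximalIdeal_eq.not.mp hR))
  have : Subsingleton (ModuleCat.of R (ResidueField R) ⟶ ModuleCat.of R K) :=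
    ModuleCat.homEquiv.subsingleton
  have := hΩ.isSimpleModule_residueField_linearMap
  rw [← (LinearEquiv.ofBijective (hS.extClass.postcompOfLinear R _ (zero_add 1))
      (bijective_postcomp_extClass hS (ModuleCat.of R (ResidueField R)))).length_eq,
    (Abelian.Ext.linearEquiv₀ (R := R)).length_eq,
    (ModuleCat.homLinearEquiv (S := R)).length_eq]
  exact Module.length_eq_one R _

end IsCanonicalFractionalIdeal

theorem IsCanonicalFractionalIdeal.isCanonicalModule {R : Type u} [CommRing R] [IsDomain R]
    [IsLocalRing R] [IsNoetherianRing R] {K : Type u} [Field K] [Algebra R K] [IsFractionRing R K]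
    {Ω : Submodule R K} (hΩ : IsCanonicalFractionalIdeal Ω) (hR : ringKrullDim R = 1) :
    IsCanonicalModule R Ω :=
  have := dimensionLEOne_of_ringKrullDim_eq_one hR
  have : Module.Finite R Ω := Module.Finite.iff_fg.mpr hΩ.fg
  have : Nontrivial Ω := Submodule.nontrivial_iff_ne_bot.mpr hΩ.ne_bot
  { isNoetherianRing := inferInstance
    isCohenMacaulay := isMaximalCohenMacaulay_of_isTorsionFree hR R
    isMaximalCohenMacaulay := isMaximalCohenMacaulay_of_isTorsionFree hR Ω
    type_eq_one := ⟨1, hR,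
      hΩ.length_ext_one_residueField (not_isField_of_ringKrullDim_eq_one hR)⟩
    finite_injectiveDimension := ⟨1, hΩ.hasInjectiveDimensionLE_one⟩ }

theorem baer_quotient_of_hasInjectiveDimensionLE {R : Type u} [CommRing R] [IsDomain R]
    [IsLocalRing R] [IsNoetherianRing R] [Ring.DimensionLEOne R] (hR : ¬ IsField R) {K : Type u}
    [Field K] [Algebra R K] [IsFractionRing R K] (Ω : Submodule R K) (d : ℕ)
    [HasInjectiveDimensionLE (ModuleCat.of R Ω) d] : Module.Baer R (K ⧸ Ω) := by
  have : Injective (ModuleCat.of R K) := injective_moduleCat_of_baer (baer_fractionRing R K)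
  have h := ((shortExact_subtype_mkQ Ω).hasInjectiveDimensionLT_X₃_iff 0 this).mpr
    (hasInjectiveDimensionLE_one_of_hasInjectiveDimensionLE hR (ModuleCat.of R Ω) d)
  rw [Module.Baer.iff_injective, Module.injective_iff_injective_object]
  exact injective_iff_hasInjectiveDimensionLT_one.mpr h

theorem IsCanonicalModule.ne_bot {R : Type u} [CommRing R] [IsLocalRing R] {ω : Ideal R}
    (hω : IsCanonicalModule R ω) : ω ≠ ⊥ :=
  have ⟨_, _, _, hrs, _⟩ := hω.isMaximalCohenMacaulay
  Submodule.nontrivial_iff_ne_bot.mp hrs.nontrivial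

theorem IsCanonicalModule.isCanonicalFractionalIdeal_coeSubmodule {R : Type u} [CommRing R]
    [IsDomain R] [IsLocalRing R] (hR : ringKrullDim R = 1) (K : Type u) [Field K] [Algebra R K]
    [IsFractionRing R K] {ω : Ideal R} (hω : IsCanonicalModule R ω) :
    IsCanonicalFractionalIdeal (IsLocalization.coeSubmodule K ω) := by
  have := hω.isNoetherianRing
  have := dimensionLEOne_of_ringKrullDim_eq_one hR
  have hF := not_isField_of_ringKrullDim_eq_one hR
  have hfg : (IsLocalization.coeSubmodule K ω).FG := (IsNoetherian.noetherian ω).map _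
  obtain ⟨d, hd⟩ := hω.finite_injectiveDimension
  have := (ModuleCat.hasInjectiveDimensionLE_iff_of_linearEquiv (M := ModuleCat.of R ω)
    (N := ModuleCat.of R (IsLocalization.coeSubmodule K ω))
    (Submodule.equivMapOfInjective (Algebra.linearMap R K) (IsFractionRing.injective R K) ω) d).mp
    hd
  exact
    { fg := hfg
      ne_bot := fun h ↦ hω.ne_bot
        (IsFractionRing.coeSubmodule_injective R K
          (h.trans (IsLocalization.coeSubmodule_bot K).symm))
      ne_top := ne_top_of_fg_of_not_isField hF hfg
      baer_quotient := baer_quotient_of_hasInjectiveDimensionLE hF _ d }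

section FiniteExtension

theorem ringKrullDim_eq_one_of_isIntegral {R : Type*} (S : Type*) [CommRing R] [IsDomain R]
    [CommRing S] [IsDomain S] [Algebra R S] [FaithfulSMul R S] [Algebra.IsIntegral R S]
    (hR : ringKrullDim R = 1) : ringKrullDim S = 1 := by
  have := dimensionLEOne_of_ringKrullDim_eq_one hR
  have : Ring.DimensionLEOne S := Ring.DimensionLEOne.of_isIntegral R S
  exact ringKrullDim_eq_one_of_not_isField fun h ↦ not_isField_of_ringKrullDim_eq_one hR
    (isField_of_isIntegral_of_isField (FaithfulSMul.algebraMap_injective R S) h)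

theorem isLocalRing_of_forall_sub_algebraMap_pow_mem {R S : Type*} [CommRing R] [IsLocalRing R]
    [CommRing S] [Nontrivial S] [Algebra R S] [Algebra.IsIntegral R S]
    (h : ∀ s : S, ∃ r : R, ∃ n : ℕ,
      (s - algebraMap R S r) ^ n ∈ (maximalIdeal R).map (algebraMap R S)) : IsLocalRing S := by
  have hcomap (M : Ideal S) (hM : M.IsMaximal) : M.comap (algebraMap R S) = maximalIdeal R :=
    eq_maximalIdeal (Ideal.isMaximal_comap_of_isIntegral_of_isMaximal M)
  have hmem (M : Ideal S) (hM : M.IsMaximal) {s : S} {r : R} {n : ℕ}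
      (hs : (s - algebraMap R S r) ^ n ∈ (maximalIdeal R).map (algebraMap R S)) :
      s ∈ M ↔ r ∈ maximalIdeal R := by
    have hsr : s - algebraMap R S r ∈ M := hM.isPrime.mem_of_pow_mem n
      (Ideal.map_le_iff_le_comap.mpr (hcomap M hM).ge hs)
    rw [← hcomap M hM, Ideal.mem_comap, ← M.sub_mem_iff_left hsr, sub_sub_cancel]
  obtain ⟨M, hM⟩ := Ideal.exists_maximal S
  refine IsLocalRing.of_unique_max_ideal ⟨M, hM, fun N hN ↦ Ideal.ext fun s ↦ ?_⟩
  obtain ⟨r, n, hs⟩ := h s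
  rw [hmem M hM hs, hmem N hN hs]

variable {R K : Type*} [CommRing R] [Field K] [Algebra R K] [IsFractionRing R K]

theorem isFractionRing_subalgebra (S : Subalgebra R K) : IsFractionRing S K := by
  refine IsFractionRing.of_field S K fun z ↦ ?_
  obtain ⟨a, b, -, hab⟩ := IsFractionRing.div_surjective (A := R) z
  exact ⟨algebraMap R S a, algebraMap R S b, hab.symm⟩

/-- The colon module `Ω / S` of a subalgebra `S`, which is not only an `R`-submodule but an
`S`-submodule. It represents `Hom_R(S, Ω)`. -/
def divSubalgebra {R A : Type*} [CommSemiring R] [CommSemiring A] [Algebra R A]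
    (Ω : Submodule R A) (S : Subalgebra R A) : Submodule S A where
  toAddSubmonoid := (Ω / Subalgebra.toSubmodule S).toAddSubmonoid
  smul_mem' s z hz t ht := by
    rw [Subalgebra.smul_def, smul_eq_mul, mul_comm (s : A) z, mul_assoc]
    exact hz _ (S.mul_mem s.2 ht)

theorem restrictScalars_divSubalgebra {R A : Type*} [CommSemiring R] [CommSemiring A] [Algebra R A]
    (Ω : Submodule R A) (S : Subalgebra R A) :
    (divSubalgebra Ω S).restrictScalars R = Ω / Subalgebra.toSubmodule S :=
  rfl

namespace IsCanonicalFractionalIdeal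

variable [IsDomain R] {Ω : Submodule R K}

theorem baer_quotient_divSubalgebra (hΩ : IsCanonicalFractionalIdeal Ω) (S : Subalgebra R K)
    [Module.Finite R S] : Module.Baer S (K ⧸ divSubalgebra Ω S) := by
  set W := divSubalgebra Ω S
  have hmem (z : K) : z ∈ W ↔ ∀ s ∈ S, z * s ∈ Ω := Submodule.mem_div_iff_forall_mul_mem
  have hWΩ : W.restrictScalars R ≤ Ω := fun z hz ↦ by simpa using (hmem z).mp hz 1 S.one_mem
  intro I f
  let π : (K ⧸ W) →ₗ[R] K ⧸ Ω := (W.restrictScalars R).mapQ Ω LinearMap.id hWΩ ∘ₗ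
    (Submodule.Quotient.restrictScalarsEquiv R W).symm.toLinearMap
  let ι : I.restrictScalars R →ₗ[R] K := S.val.toLinearMap ∘ₗ (I.restrictScalars R).subtype
  obtain ⟨g, hg⟩ := hΩ.baer_quotient.extension_property ι
    (Subtype.val_injective.comp Subtype.val_injective) (π ∘ₗ f.restrictScalars R)
  obtain ⟨y, hy⟩ := exists_eq_mkQ_mul_of_fg
    (Module.Finite.iff_fg.mp ‹_› : (Subalgebra.toSubmodule S).FG) g
  have hπ (i : I) : π (f i) = Ω.mkQ (y * (i : S)) := by
    rw [← hy _ (i : S).2]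
    exact (LinearMap.congr_fun hg i).symm
  refine ⟨LinearMap.toSpanSingleton S _ (W.mkQ y), fun i hi ↦ ?_⟩
  obtain ⟨z, hz⟩ := W.mkQ_surjective (f ⟨i, hi⟩)
  rw [LinearMap.toSpanSingleton_apply, ← map_smul, ← hz]
  refine ((Submodule.Quotient.eq W).mpr ((hmem _).mpr fun s hs ↦ ?_)).symm
  have hs' := hπ ((⟨s, hs⟩ : S) • ⟨i, hi⟩)
  rw [map_smul, ← hz, ← map_smul, show ∀ z, π (W.mkQ z) = Ω.mkQ z from fun _ ↦ rfl] at hs'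
  convert (Submodule.Quotient.eq Ω).mp hs' using 1
  simp only [Subalgebra.smul_def, smul_eq_mul, SetLike.val_smul, MulMemClass.coe_mul]
  ring

theorem divSubalgebra [IsNoetherianRing R] (hΩ : IsCanonicalFractionalIdeal Ω)
    (S : Subalgebra R K) [Module.Finite R S] :
    IsCanonicalFractionalIdeal (divSubalgebra Ω S) where
  fg := by
    have hS : Subalgebra.toSubmodule S ≠ ⊥ :=
      (Submodule.ne_bot_iff _).mpr ⟨1, S.one_mem, one_ne_zero⟩
    exact Submodule.FG.of_restrictScalars R
      (restrictScalars_divSubalgebra Ω S ▸ fg_div_of_ne_bot hΩ.fg hS)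
  ne_bot h := div_ne_bot_of_fg hΩ.ne_bot (Module.Finite.iff_fg.mp ‹_›) <|
    (restrictScalars_divSubalgebra Ω S).symm.trans
      ((Submodule.restrictScalars_eq_bot_iff _ _ _).mpr h)
  ne_top h := hΩ.ne_top <| top_le_iff.mp fun z _ ↦ by
    have hz : z ∈ (⊤ : Submodule S K) := trivial
    rw [← h] at hz
    simpa using Submodule.mem_div_iff_forall_mul_mem.mp hz 1 S.one_mem
  baer_quotient := hΩ.baer_quotient_divSubalgebra S

end IsCanonicalFractionalIdeal

end FiniteExtension

section FiniteIntegralClosure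

theorem isPrecomplete_pi {R : Type*} [CommRing R] (I : Ideal R) [IsPrecomplete I R]
    (ι : Type*) [Finite ι] : IsPrecomplete I (ι → R) where
  prec' f hf := by
    classical
    have := Fintype.ofFinite ι
    have hfi (i : ι) {m n : ℕ} (hmn : m ≤ n) :
        f m i ≡ f n i [SMOD (I ^ m • ⊤ : Submodule R R)] := by
      have h := Submodule.mem_map_of_mem (f := LinearMap.proj (R := R) (φ := fun _ : ι ↦ R) i)
        (SModEq.sub_mem.mp (hf hmn))
      rw [Submodule.map_smul''] at h
      exact SModEq.sub_mem.mpr (Submodule.smul_mono le_rfl le_top h)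
    choose L hL using fun i ↦ IsPrecomplete.prec inferInstance (hfi i)
    refine ⟨L, fun n ↦ SModEq.sub_mem.mpr ?_⟩
    rw [pi_eq_sum_univ' (f n - L)]
    refine Submodule.sum_mem _ fun i _ ↦ Submodule.smul_mem_smul ?_ trivial
    simpa using SModEq.sub_mem.mp (hL i n)

theorem finite_of_finite_quotient_smul_top {R M : Type*} [CommRing R] [AddCommGroup M] [Module R M]
    (I : Ideal R) [IsPrecomplete I R] [IsHausdorff I M]
    [Module.Finite R (M ⧸ (I • ⊤ : Submodule R M))] : Module.Finite R M := by
  obtain ⟨n, f, hf⟩ := Module.Finite.exists_fin' R (M ⧸ (I • ⊤ : Submodule R M))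
  obtain ⟨g, hg⟩ := Module.projective_lifting_property (I • ⊤ : Submodule R M).mkQ f
    (Submodule.mkQ_surjective _)
  have := isPrecomplete_pi I (Fin n)
  exact Module.Finite.of_surjective g (surjective_of_mkQ_comp_surjective (I := I) (hg ▸ hf))

theorem exists_le_sup_span_singleton_of_antitone {R : Type*} [CommRing R] [IsDomain R]
    [IsNoetherianRing R] [Ring.DimensionLEOne R] {J : ℕ → Ideal R} (hJ : Antitone J)
    {x : R} (hx : x ≠ 0) : ∃ n : ℕ, ∀ m, n ≤ m → J m ≤ J (m + 1) ⊔ Ideal.span {x} := by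
  have : Ring.KrullDimLE 1 R := Ring.krullDimLE_one_iff_of_noZeroDivisors.mpr
    fun I hI hIp ↦ Ring.DimensionLEOne.maximalOfPrime hI hIp
  have : IsArtinian R (R ⧸ Ideal.span {x}) := (isFiniteLength_iff_isNoetherian_isArtinian.mp
    (isFiniteLength_quotient_span_singleton R (mem_nonZeroDivisors_of_ne_zero hx))).2
  obtain ⟨n, hn⟩ := IsArtinian.monotone_stabilizes
    ⟨fun m ↦ OrderDual.toDual (Submodule.map (Ideal.span {x}).mkQ (J m)),
      fun _ _ h ↦ Submodule.map_mono (hJ h)⟩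
  have hmap {m : ℕ} (hm : n ≤ m) : Submodule.map (Ideal.span {x}).mkQ (J m) =
      Submodule.map (Ideal.span {x}).mkQ (J (m + 1)) :=
    (hn m hm).symm.trans (hn (m + 1) (by omega))
  refine ⟨n, fun m hm ↦ (Submodule.le_comap_map (Ideal.span {x}).mkQ (J m)).trans ?_⟩
  rw [hmap hm, Submodule.comap_map_mkQ, sup_comm]

variable {R : Type*} [CommRing R] [IsLocalRing R] [IsNoetherianRing R] [Ring.DimensionLEOne R]

theorem exists_maximalIdeal_pow_le {I : Ideal R} (hI : I ≠ ⊥) :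
    ∃ n : ℕ, maximalIdeal R ^ n ≤ I := by
  refine Ideal.exists_pow_le_of_le_radical_of_fg ?_ (IsNoetherian.noetherian _)
  rw [Ideal.radical_eq_sInf]
  refine le_sInf fun p ⟨hIp, hp⟩ ↦ ?_
  exact (eq_maximalIdeal (Ring.DimensionLEOne.maximalOfPrime (ne_bot_of_le_ne_bot hI hIp) hp)).ge

theorem isHausdorff_maximalIdeal_of_isIntegral (B : Type*) [CommRing B] [IsDomain B] [Algebra R B]
    [FaithfulSMul R B] [Algebra.IsIntegral R B] : IsHausdorff (maximalIdeal R) B := by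
  rw [← IsHausdorff.map_algebraMap_iff (S := B)]
  set J := (maximalIdeal R).map (algebraMap R B) with hJ
  have hJtop : J ≠ ⊤ := (Ideal.map_eq_top_iff _ (FaithfulSMul.algebraMap_injective R B)
    (algebraMap_isIntegral_iff.mpr inferInstance)).not.mpr (maximalIdeal.isMaximal R).ne_top
  refine ⟨fun z hz ↦ by_contra fun hz0 ↦ ?_⟩
  have hzJ (n : ℕ) : z ∈ J ^ n := by simpa using SModEq.zero.mp (hz n)
  obtain ⟨n, hn⟩ := exists_maximalIdeal_pow_le
    (Ideal.IsIntegral.comap_ne_bot R (Ideal.span_singleton_eq_bot.not.mpr hz0))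
  have hJn : J ^ n ≤ Ideal.span {z} := by
    rw [hJ, ← Ideal.map_pow]
    exact Ideal.map_le_iff_le_comap.mpr hn
  have hz' : z ∈ J * Ideal.span {z} := Ideal.mul_mono_right hJn (pow_succ' J n ▸ hzJ (n + 1))
  obtain ⟨u, hu, huz⟩ := Ideal.mem_mul_span_singleton.mp hz'
  exact hJtop (J.eq_top_of_isUnit_mem hu ((mul_eq_right₀ hz0).mp huz ▸ isUnit_one))

variable {K : Type*} [Field K] [Algebra R K] [IsFractionRing R K]

theorem exists_eq_smul_pow_inv {x : R} (hx : x ∈ maximalIdeal R) (hx0 : x ≠ 0) (n : ℕ) (y : K) :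
    ∃ m, n ≤ m ∧ ∃ r : R, y = r • (algebraMap R K x ^ m)⁻¹ := by
  have hxK : algebraMap R K x ≠ 0 := by simpa using hx0
  obtain ⟨a, b, hb, rfl⟩ := IsFractionRing.div_surjective (A := R) y
  have hbK := IsLocalization.to_map_ne_zero_of_mem_nonZeroDivisors K le_rfl hb
  obtain ⟨j, hj⟩ := exists_maximalIdeal_pow_le
    (Ideal.span_singleton_eq_bot.not.mpr (nonZeroDivisors.ne_zero hb))
  obtain ⟨s, hs⟩ := Ideal.mem_span_singleton'.mp (hj (Ideal.pow_mem_pow hx j))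
  refine ⟨n + j, Nat.le_add_right n j, a * (x ^ n * s), ?_⟩
  rw [Algebra.smul_def, ← div_eq_mul_inv, div_eq_div_iff hbK (pow_ne_zero _ hxK)]
  simp only [← map_pow, ← map_mul, pow_add, ← hs]
  ring_nf

variable [IsDomain R]

open scoped Pointwise in
/- The Krull–Akizuki argument: the ideals `{r | r / x ^ n ∈ M}` form a decreasing chain, which
stabilizes modulo `x`. -/
theorem exists_le_inf_span_sup_smul (M : Submodule R K) {x : R} (hx : x ∈ maximalIdeal R)
    (hx0 : x ≠ 0) :
    ∃ n : ℕ, M ≤ M ⊓ Submodule.span R {(algebraMap R K x ^ n)⁻¹} ⊔ x • M := by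
  have hxK : algebraMap R K x ≠ 0 := by simpa using hx0
  let J (n : ℕ) : Ideal R := M.comap (LinearMap.toSpanSingleton R K (algebraMap R K x ^ n)⁻¹)
  have hmem (n : ℕ) (r : R) : r ∈ J n ↔ r • (algebraMap R K x ^ n)⁻¹ ∈ M := Iff.rfl
  have hsmul (n : ℕ) (r : R) :
      x • r • (algebraMap R K x ^ (n + 1))⁻¹ = r • (algebraMap R K x ^ n)⁻¹ := by
    simp only [Algebra.smul_def, pow_succ]
    field_simp
  have hJ : Antitone J := antitone_nat_of_succ_le fun n r hr ↦ by
    rw [hmem, ← hsmul]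
    exact M.smul_mem x hr
  obtain ⟨n, hn⟩ := exists_le_sup_span_singleton_of_antitone hJ hx0
  have hJn (m : ℕ) (hm : n ≤ m) : ∀ r ∈ J m, r • (algebraMap R K x ^ m)⁻¹ ∈
      M ⊓ Submodule.span R {(algebraMap R K x ^ n)⁻¹} ⊔ x • M := by
    induction m, hm using Nat.le_induction with
    | base =>
      exact fun r hr ↦ Submodule.mem_sup_left
        ⟨hr, Submodule.smul_mem _ r (Submodule.mem_span_singleton_self _)⟩
    | succ m hm ih =>
      intro r hr
      obtain ⟨r', hr', t, ht, rfl⟩ := Submodule.mem_sup.mp (hn _ (hm.trans m.le_succ) hr)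
      obtain ⟨s, rfl⟩ := Ideal.mem_span_singleton'.mp ht
      have hr'M : r' • (algebraMap R K x ^ (m + 1))⁻¹ ∈ x • M :=
        hsmul (m + 1) r' ▸ Submodule.smul_mem_pointwise_smul _ x M hr'
      rw [hmem, add_smul, mul_comm, mul_smul, hsmul] at hr
      rw [add_smul, mul_comm, mul_smul, hsmul]
      exact add_mem (Submodule.mem_sup_right hr'M)
        (ih s ((M.add_mem_iff_right (Submodule.smul_le_self_of_tower x M hr'M)).mp hr))
  refine ⟨n, fun y hy ↦ ?_⟩
  obtain ⟨m, hm, r, rfl⟩ := exists_eq_smul_pow_inv hx hx0 n y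
  exact hJn m hm r hy

theorem finite_of_isHausdorff_maximalIdeal [IsPrecomplete (maximalIdeal R) R]
    (hR : ¬ IsField R) (M : Submodule R K) [IsHausdorff (maximalIdeal R) M] :
    Module.Finite R M := by
  obtain ⟨x, hx, hx0⟩ :=
    (Submodule.ne_bot_iff _).mp (isField_iff_maximalIdeal_eq.not.mp hR)
  obtain ⟨n, hn⟩ := exists_le_inf_span_sup_smul M hx hx0
  set N := Submodule.span R {(algebraMap R K x ^ n)⁻¹}
  have : IsNoetherian R (M ⊓ N : Submodule R K) := isNoetherian_of_le inf_le_right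
  have : Module.Finite R (M ⧸ (maximalIdeal R • ⊤ : Submodule R M)) := by
    refine Module.Finite.of_surjective
      ((maximalIdeal R • ⊤ : Submodule R M).mkQ ∘ₗ Submodule.inclusion (inf_le_left : M ⊓ N ≤ M))
      fun q ↦ ?_
    obtain ⟨y, rfl⟩ := Submodule.mkQ_surjective _ q
    obtain ⟨z, hz, _, ⟨w, hw, rfl⟩, hzw⟩ := Submodule.mem_sup.mp (hn y.2)
    refine ⟨⟨z, hz⟩, ((Submodule.Quotient.eq _).mpr ?_).symm⟩
    have hyz : y - ⟨z, hz.1⟩ = x • (⟨w, hw⟩ : M) :=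
      Subtype.ext (sub_eq_of_eq_add' hzw.symm)
    exact hyz ▸ Submodule.smul_mem_smul hx Submodule.mem_top
  exact finite_of_finite_quotient_smul_top (maximalIdeal R)

theorem finite_integralClosure [IsAdicComplete (maximalIdeal R) R] (hR : ¬ IsField R) (K : Type*)
    [Field K] [Algebra R K] [IsFractionRing R K] : Module.Finite R (integralClosure R K) :=
  have : IsHausdorff (maximalIdeal R) (Subalgebra.toSubmodule (integralClosure R K)) :=
    isHausdorff_maximalIdeal_of_isIntegral (integralClosure R K)
  finite_of_isHausdorff_maximalIdeal hR (Subalgebra.toSubmodule (integralClosure R K))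

end FiniteIntegralClosure

theorem le_idealIntegralClosure {R : Type u} [CommRing R] (I : Ideal R) :
    I ≤ idealIntegralClosure I := fun r hr ↦
  have hmem : monomial 1 r ∈ reesAlgebra I := reesAlgebra.monomial_mem.mpr (by rwa [pow_one])
  (isIntegralOverIdeal_iff_rees I r).mpr (isIntegral_algebraMap (x := (⟨_, hmem⟩ : reesAlgebra I)))

theorem IsIntegralOverIdeal.map {R S : Type*} [CommRing R] [CommRing S] (f : R →+* S) {I : Ideal R}
    {r : R} (h : IsIntegralOverIdeal I r) : IsIntegralOverIdeal (I.map f) (f r) := by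
  obtain ⟨n, hn, a, ha, h0⟩ := h
  refine ⟨n, hn, fun i ↦ f (a i), fun i ↦ Ideal.map_pow f I i ▸ Ideal.mem_map_of_mem f (ha i), ?_⟩
  simpa using congrArg f h0

theorem isIntegral_of_pow_add_sum_eq_zero {B L : Type*} [CommRing B] [CommRing L] [Algebra B L]
    {n : ℕ} {b : ℕ → B} {z : L}
    (h : z ^ n + ∑ i ∈ Finset.Icc 1 n, algebraMap B L (b i) * z ^ (n - i) = 0) :
    IsIntegral B z := by
  refine ⟨X ^ n + ∑ i ∈ Finset.Icc 1 n, C (b i) * X ^ (n - i), monic_X_pow_add ?_, ?_⟩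
  · refine (degree_sum_le _ _).trans_lt ((Finset.sup_lt_iff (WithBot.bot_lt_coe n)).mpr ?_)
    exact fun i hi ↦ (degree_C_mul_X_pow_le _ _).trans_lt (Nat.cast_lt.mpr (by grind))
  · simpa only [eval₂_add, eval₂_X_pow, eval₂_finsetSum, eval₂_mul, eval₂_C] using h

theorem IsIntegralOverIdeal.mem_span_singleton {B : Type*} [CommRing B] [IsDomain B]
    [IsIntegrallyClosed B] {β s : B} (h : IsIntegralOverIdeal (Ideal.span {β}) s) :
    s ∈ Ideal.span {β} := by
  obtain ⟨n, hn, a, ha, h0⟩ := h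
  simp only [Ideal.span_singleton_pow, Ideal.mem_span_singleton] at ha
  choose b hb using ha
  rcases eq_or_ne β 0 with rfl | hβ
  · have hs : s ^ n = 0 := by
      rwa [Finset.sum_eq_zero, add_zero] at h0
      intro i hi
      rw [hb, zero_pow (by grind), zero_mul, zero_mul]
    rw [eq_zero_of_pow_eq_zero hs]
    exact zero_mem _
  let L := FractionRing B
  have hβL : algebraMap B L β ≠ 0 := by simpa using hβ
  have hz : (algebraMap B L s / algebraMap B L β) ^ n + ∑ i ∈ Finset.Icc 1 n,
      algebraMap B L (b i) * (algebraMap B L s / algebraMap B L β) ^ (n - i) = 0 := by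
    refine (mul_eq_zero_iff_left (pow_ne_zero n hβL)).mp ?_
    rw [← map_zero (algebraMap B L), ← h0, mul_add,
      Finset.mul_sum, map_add, map_sum]
    congr 1
    · rw [div_pow, mul_div_cancel₀ _ (pow_ne_zero n hβL), map_pow]
    · refine Finset.sum_congr rfl fun i hi ↦ ?_
      obtain ⟨m, rfl⟩ := Nat.exists_eq_add_of_le (Finset.mem_Icc.mp hi).2
      rw [Nat.add_sub_cancel_left, hb, map_mul, map_mul, map_pow, map_pow, pow_add,
        mul_mul_mul_comm, div_pow, mul_div_cancel₀ _ (pow_ne_zero m hβL)]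
  obtain ⟨t, ht⟩ := IsIntegrallyClosed.isIntegral_iff.mp (isIntegral_of_pow_add_sum_eq_zero hz)
  refine Ideal.mem_span_singleton'.mpr ⟨t, IsFractionRing.injective B L ?_⟩
  rw [map_mul, ht, div_mul_cancel₀ _ hβL]

theorem isIntegralOverIdeal_of_monic {R : Type*} [CommRing R] [Nontrivial R] {I : Ideal R} {r : R}
    {p : R[X]} (hp : p.Monic) (hcoeff : ∀ i, p.coeff i ∈ I ^ (p.natDegree - i))
    (hr : p.eval r = 0) : IsIntegralOverIdeal I r := by
  have hn : 0 < p.natDegree := Nat.pos_of_ne_zero fun h0 ↦ by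
    rw [eq_one_of_monic_natDegree_zero hp h0, eval_one] at hr
    exact one_ne_zero hr
  refine ⟨p.natDegree, hn, fun i ↦ if i ≤ p.natDegree then p.coeff (p.natDegree - i) else 0,
    fun i ↦ ?_, ?_⟩
  · dsimp only
    split_ifs with hi
    · simpa only [Nat.sub_sub_self hi] using hcoeff (p.natDegree - i)
    · exact zero_mem _
  · rw [← hr, eval_eq_sum_range, Finset.sum_range_succ, hp.coeff_natDegree, one_mul, add_comm]
    congr 1
    exact Finset.sum_nbij' (p.natDegree - ·) (p.natDegree - ·) (by grind) (by grind) (by grind)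
      (by grind) (by grind)

theorem isIntegralOverIdeal_of_algebraMap_mem_map {R : Type*} (B : Type*) [CommRing R] [CommRing B]
    [Nontrivial B] [Algebra R B] [FaithfulSMul R B] [Module.Finite R B] {I : Ideal R} {r : R}
    (h : algebraMap R B r ∈ I.map (algebraMap R B)) : IsIntegralOverIdeal I r := by
  have hrange : LinearMap.range (algebraMap R (Module.End R B) r) ≤ I • ⊤ := by
    rintro _ ⟨b, rfl⟩
    rw [Ideal.smul_top_eq_map, Submodule.restrictScalars_mem, Module.algebraMap_end_apply,
      Algebra.smul_def]
    exact Ideal.mul_mem_right b _ h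
  obtain ⟨p, hp, -, hcoeff, h0⟩ :=
    LinearMap.exists_monic_and_natDegree_eq_and_coeff_mem_pow_and_aeval_eq_zero R _ I hrange
  have : Nontrivial R := (algebraMap R B).domain_nontrivial
  refine isIntegralOverIdeal_of_monic hp hcoeff (FaithfulSMul.algebraMap_injective R B ?_)
  rw [aeval_algebraMap_apply] at h0
  simpa [Algebra.smul_def] using LinearMap.congr_fun h0 1

theorem idealIntegralClosure_eq_comap_map {R : Type*} (B : Type*) [CommRing R] [CommRing B]
    [IsDomain B] [IsPrincipalIdealRing B] [Algebra R B] [FaithfulSMul R B] [Module.Finite R B]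
    (I : Ideal R) :
    idealIntegralClosure I = (I.map (algebraMap R B)).comap (algebraMap R B) := by
  refine le_antisymm (fun r hr ↦ ?_) fun r ↦ isIntegralOverIdeal_of_algebraMap_mem_map B
  obtain ⟨β, hβ⟩ := IsPrincipalIdealRing.principal (I.map (algebraMap R B))
  have h : IsIntegralOverIdeal _ _ := IsIntegralOverIdeal.map (algebraMap R B) hr
  rw [hβ] at h
  rw [Ideal.mem_comap, hβ]
  exact h.mem_span_singleton

theorem IsIdealReduction.map_eq_map {R B : Type*} [CommRing R] [CommRing B] [IsDomain B]
    [IsDedekindRing B] {J I : Ideal R} (h : IsIdealReduction J I) (f : R →+* B) :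
    J.map f = I.map f := by
  obtain ⟨hJI, n, hn⟩ := h
  rcases eq_or_ne (I.map f) ⊥ with hI | hI
  · exact (le_bot_iff.mp ((Ideal.map_mono hJI).trans hI.le)).trans hI.symm
  · refine mul_right_cancel₀ (pow_ne_zero n hI) ?_
    rw [← Ideal.map_pow, ← Ideal.map_mul, hn, pow_succ', Ideal.map_mul]

theorem isPrincipalIdealRing_of_finite (R B : Type*) [CommRing R] [IsDomain R] [IsLocalRing R]
    [IsNoetherianRing R] [Ring.DimensionLEOne R] [CommRing B] [IsDomain B] [IsIntegrallyClosed B]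
    [Algebra R B] [FaithfulSMul R B] [Module.Finite R B] : IsPrincipalIdealRing B := by
  have : IsNoetherianRing B := IsNoetherianRing.of_finite R B
  have : Ring.DimensionLEOne B := Ring.DimensionLEOne.of_isIntegral R B
  have : IsDedekindDomain B := {}
  refine IsPrincipalIdealRing.of_finite_maximals
    ((IsDedekindDomain.primesOver_finite (maximalIdeal R) B).subset fun M hM ↦ ?_)
  have hM' : M.IsMaximal := hM
  exact ⟨hM'.isPrime, ⟨(eq_maximalIdeal
    (Ideal.isMaximal_comap_of_isIntegral_of_isMaximal M)).symm⟩⟩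

theorem map_val_restrictScalars_map_algebraMap {R K : Type*} [CommRing R] [Field K] [Algebra R K]
    (B : Subalgebra R K) (I : Ideal R) :
    Submodule.map B.val.toLinearMap ((I.map (algebraMap R B)).restrictScalars R) =
      IsLocalization.coeSubmodule K I * Subalgebra.toSubmodule B := by
  rw [← Ideal.smul_top_eq_map, Submodule.map_smul'', Submodule.map_top, Submodule.smul_eq_map₂,
    Submodule.mul_eq_map₂, IsLocalization.coeSubmodule, Submodule.map₂_map_left]
  congr 1
  · ext; simp [Algebra.smul_def]
  · exact congrArg Subalgebra.toSubmodule B.range_val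

theorem isIntegrallyClosed_integralClosure (R K : Type*) [CommRing R] [Field K]
    [Algebra R K] [IsFractionRing R K] : IsIntegrallyClosed (integralClosure R K) := by
  have := isFractionRing_subalgebra (integralClosure R K)
  exact (isIntegrallyClosed_iff_isIntegrallyClosedIn K).mpr inferInstance

theorem mem_idealIntegralClosure_iff {R K : Type*} [CommRing R] [IsDomain R] [Field K] [Algebra R K]
    [IsFractionRing R K] (B : Subalgebra R K) [IsPrincipalIdealRing B] [Module.Finite R B]
    {I : Ideal R} {r : R} : r ∈ idealIntegralClosure I ↔
      algebraMap R K r ∈ IsLocalization.coeSubmodule K I * Subalgebra.toSubmodule B := by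
  rw [idealIntegralClosure_eq_comap_map B, Ideal.mem_comap,
    ← map_val_restrictScalars_map_algebraMap]
  exact ⟨fun h ↦ ⟨_, h, rfl⟩, fun ⟨b, hb, h⟩ ↦ (Subtype.ext h : b = algebraMap R B r) ▸ hb⟩

theorem IsIdealReduction.coeSubmodule_mul_eq {R K : Type*} [CommRing R] [Field K] [Algebra R K]
    {J I : Ideal R} (h : IsIdealReduction J I) (B : Subalgebra R K) [IsDedekindRing B] :
    IsLocalization.coeSubmodule K J * Subalgebra.toSubmodule B =
      IsLocalization.coeSubmodule K I * Subalgebra.toSubmodule B := by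
  rw [← map_val_restrictScalars_map_algebraMap, ← map_val_restrictScalars_map_algebraMap,
    h.map_eq_map]

theorem coeSubmodule_inf_idealIntegralClosure {R K : Type*} [CommRing R] [IsDomain R] [Field K]
    [Algebra R K] [IsFractionRing R K] (B : Subalgebra R K) [IsPrincipalIdealRing B]
    [Module.Finite R B] (I J : Ideal R) :
    IsLocalization.coeSubmodule K (I ⊓ idealIntegralClosure J) =
      IsLocalization.coeSubmodule K I ⊓
        IsLocalization.coeSubmodule K J * Subalgebra.toSubmodule B := by
  ext z
  constructor
  · rintro ⟨r, ⟨hrI, hrJ⟩, rfl⟩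
    exact ⟨⟨r, hrI, rfl⟩, (mem_idealIntegralClosure_iff B).mp hrJ⟩
  · rintro ⟨⟨r, hrI, rfl⟩, hrJ⟩
    exact ⟨r, ⟨hrI, (mem_idealIntegralClosure_iff B).mpr hrJ⟩, rfl⟩

section Div

variable {R A : Type*} [CommSemiring R] [CommSemiring A] [Algebra R A] (I J L : Submodule R A)

theorem submodule_div_one : I / 1 = I :=
  eq_of_forall_le_iff fun N ↦ by rw [Submodule.le_div_iff_mul_le, mul_one]

theorem submodule_div_div : I / J / L = I / (J * L) :=
  eq_of_forall_le_iff fun N ↦ by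
    simp only [Submodule.le_div_iff_mul_le, mul_assoc, mul_comm L J]

theorem submodule_div_sup : I / (J ⊔ L) = I / J ⊓ I / L :=
  eq_of_forall_le_iff fun N ↦ by
    simp only [le_inf_iff, Submodule.le_div_iff_mul_le, Submodule.mul_sup, sup_le_iff]

theorem span_singleton_mul_span_singleton_inv {R K : Type*} [CommSemiring R] [Field K] [Algebra R K]
    {a : K} (ha : a ≠ 0) : Submodule.span R {a} * Submodule.span R {a⁻¹} = 1 := by
  rw [Submodule.span_mul_span, Set.singleton_mul_singleton, mul_inv_cancel₀ ha,
    Submodule.one_eq_span]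

theorem submodule_div_span_singleton_inv {R K : Type*} [CommSemiring R] [Field K] [Algebra R K]
    {a : K} (ha : a ≠ 0) (I : Submodule R K) :
    I / Submodule.span R {a⁻¹} = Submodule.span R {a} * I := by
  refine le_antisymm ?_ ?_
  · rw [← one_mul (I / _), ← span_singleton_mul_span_singleton_inv ha, mul_assoc]
    refine mul_le_mul_right ?_ _
    rw [mul_comm, ← Submodule.le_div_iff_mul_le]
  · rw [Submodule.le_div_iff_mul_le, mul_right_comm, span_singleton_mul_span_singleton_inv ha,
      one_mul]

end Div

theorem toSubmodule_adjoin_of_mul_self_le {R A : Type*} [CommSemiring R] [CommSemiring A]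
    [Algebra R A] {N : Submodule R A} (hN : N * N ≤ 1 ⊔ N) :
    Subalgebra.toSubmodule (Algebra.adjoin R (N : Set A)) = 1 ⊔ N := by
  have hmul : (1 ⊔ N) * (1 ⊔ N) ≤ 1 ⊔ N := by
    simp only [Submodule.sup_mul, Submodule.mul_sup, one_mul, mul_one]
    exact sup_le le_rfl (sup_le le_sup_right hN)
  refine le_antisymm ?_
    (sup_le (Submodule.one_le.mpr (Subalgebra.one_mem _)) Algebra.subset_adjoin)
  have hle : Algebra.adjoin R (N : Set A) ≤ (1 ⊔ N).toSubalgebra (Submodule.one_le.mp le_sup_left)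
      fun a b ha hb ↦ hmul (Submodule.mul_mem_mul ha hb) :=
    Algebra.adjoin_le (le_sup_right : N ≤ 1 ⊔ N)
  exact hle

section Transform

open IsLocalization (coeSubmodule)

variable {R : Type u} [CommRing R] {K : Type u} [Field K] [Algebra R K]

theorem coeSubmodule_conductorIdeal :
    coeSubmodule K (conductorIdeal R K) = 1 / Subalgebra.toSubmodule (integralClosure R K) := by
  refine (Submodule.map_comap_eq _ _).trans (inf_eq_right.mpr fun z hz ↦ ?_)
  rw [← Submodule.one_eq_range]
  simpa only [mul_one] using hz 1 (one_mem (integralClosure R K))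

theorem coeSubmodule_conductorIdeal_mul_integralClosure :
    coeSubmodule K (conductorIdeal R K) * Subalgebra.toSubmodule (integralClosure R K) =
      coeSubmodule K (conductorIdeal R K) := by
  refine le_antisymm ?_
    (le_mul_of_one_le_right' (Submodule.one_le.mpr (integralClosure R K).one_mem))
  rw [coeSubmodule_conductorIdeal, Submodule.le_div_iff_mul_le, mul_assoc,
    Subalgebra.isIdempotentElem_toSubmodule, ← Submodule.le_div_iff_mul_le]

theorem IsIdealReduction.coeSubmodule_mul_conductorIdeal [IsDedekindRing (integralClosure R K)]
    {I : Ideal R} {x : R} (hx : IsIdealReduction (Ideal.span {x}) I) :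
    coeSubmodule K I * coeSubmodule K (conductorIdeal R K) =
      Submodule.span R {algebraMap R K x} * coeSubmodule K (conductorIdeal R K) := by
  rw [← coeSubmodule_conductorIdeal_mul_integralClosure, mul_left_comm,
    ← hx.coeSubmodule_mul_eq, IsLocalization.coeSubmodule_span_singleton, mul_left_comm]

theorem IsCanonicalFractionalIdeal.div_coeSubmodule_conductorIdeal [IsDomain R] [IsLocalRing R]
    [IsNoetherianRing R] [Ring.DimensionLEOne R] [IsFractionRing R K]
    [Module.Finite R (integralClosure R K)] {Ω : Submodule R K}
    (hΩ : IsCanonicalFractionalIdeal Ω) :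
    Ω / coeSubmodule K (conductorIdeal R K) =
      Ω * Subalgebra.toSubmodule (integralClosure R K) := by
  have hΩΩ : Ω / Ω = 1 := by
    simpa only [submodule_div_one] using hΩ.div_div_eq_self (I := 1)
      (Submodule.one_eq_span (R := R) (A := K) ▸ Submodule.fg_span_singleton _)
  rw [coeSubmodule_conductorIdeal, ← hΩΩ, submodule_div_div]
  exact hΩ.div_div_eq_self (hΩ.fg.mul (Module.Finite.iff_fg.mp ‹_›))

variable [IsLocalRing R] [IsFractionRing R K] [IsDedekindRing (integralClosure R K)]
  {x : R}

theorem span_inv_mul_conductorIdeal_mul_self_le (hx0 : x ≠ 0)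
    (hx : IsIdealReduction (Ideal.span {x}) (maximalIdeal R))
    (hC : conductorIdeal R K ≤ maximalIdeal R ^ 2) :
    Submodule.span R {(algebraMap R K x)⁻¹} * coeSubmodule K (conductorIdeal R K) *
        (Submodule.span R {(algebraMap R K x)⁻¹} * coeSubmodule K (conductorIdeal R K)) ≤
      coeSubmodule K (conductorIdeal R K) := by
  have hxK : algebraMap R K x ≠ 0 := by simpa using hx0
  set u := Submodule.span R {(algebraMap R K x)⁻¹}
  set 𝔠 := coeSubmodule K (conductorIdeal R K)
  set 𝔪 := coeSubmodule K (maximalIdeal R)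
  have h𝔠 : 𝔠 ≤ 𝔪 * 𝔪 := by
    rw [← IsLocalization.coeSubmodule_mul, ← pow_two]
    exact IsLocalization.coeSubmodule_mono K hC
  have hu : u * (𝔪 * 𝔠) = 𝔠 := by
    rw [hx.coeSubmodule_mul_conductorIdeal, ← mul_assoc, mul_comm u,
      span_singleton_mul_span_singleton_inv hxK, one_mul]
  calc u * 𝔠 * (u * 𝔠) ≤ u * (𝔪 * 𝔪) * (u * 𝔠) := by gcongr
    _ = u * (𝔪 * (u * (𝔪 * 𝔠))) := by ring
    _ = 𝔠 := by rw [hu, hu]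

theorem toSubmodule_conductorTransform (hx0 : x ≠ 0)
    (hx : IsIdealReduction (Ideal.span {x}) (maximalIdeal R))
    (hC : conductorIdeal R K ≤ maximalIdeal R ^ 2) :
    Subalgebra.toSubmodule (conductorTransform R K x) =
      1 ⊔ Submodule.span R {(algebraMap R K x)⁻¹} * coeSubmodule K (conductorIdeal R K) := by
  have h𝔠 : coeSubmodule K (conductorIdeal R K) ≤ 1 :=
    (IsLocalization.coeSubmodule_mono K le_top).trans (IsLocalization.coeSubmodule_top K).le
  have hgen : {z : K | ∃ c ∈ conductorIdeal R K, z = algebraMap R K c / algebraMap R K x} =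
      (Submodule.span R {(algebraMap R K x)⁻¹} * coeSubmodule K (conductorIdeal R K) :
        Submodule R K) := by
    ext z
    simp only [Set.mem_ofPred_eq, SetLike.mem_coe, Submodule.mem_span_singleton_mul,
      IsLocalization.mem_coeSubmodule, exists_exists_and_eq_and, div_eq_inv_mul, @eq_comm _ z]
  rw [conductorTransform, hgen]
  exact toSubmodule_adjoin_of_mul_self_le
    (((span_inv_mul_conductorIdeal_mul_self_le hx0 hx hC).trans h𝔠).trans le_sup_left)

end Transform

section ResidueRank

variable {R M : Type u} [CommRing R] [AddCommGroup M] [Module R M]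

theorem minNumGenerators_lt_aleph0 [Module.Finite R M] :
    minNumGenerators R M < Cardinal.aleph0 :=
  Submodule.spanRank_finite_iff_fg.mpr Module.Finite.fg_top

variable [IsLocalRing R]

theorem length_eq_toENat_minNumGenerators (hM : Module.IsTorsionBySet R M (maximalIdeal R)) :
    Module.length R M = (minNumGenerators R M).toENat := by
  let : Module (ResidueField R) M := hM.module
  have : IsScalarTower R (ResidueField R) M := hM.isScalarTower
  rw [Module.length_eq_of_surjective (residue_surjective (R := R)), Module.length_eq_rank,
    Submodule.rank_eq_spanRank_of_free,
    ← Submodule.spanRank_restrictScalars_eq (R := R) residue_surjective]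
  rfl

theorem rank_eq_minNumGenerators {k : Type v} [Field k] [Algebra k R] [Module k M]
    [IsScalarTower k R M] (hk : Function.Surjective (algebraMap k (ResidueField R)))
    (hM : Module.IsTorsionBySet R M (maximalIdeal R)) :
    Module.rank k M = minNumGenerators R M := by
  let : Module (ResidueField R) M := hM.module
  have : IsScalarTower R (ResidueField R) M := hM.isScalarTower
  have : IsScalarTower k (ResidueField R) M := hM.isScalarTower
  rw [Submodule.rank_eq_spanRank_of_free, ← Submodule.restrictScalars_top k (ResidueField R) M,
    Submodule.spanRank_restrictScalars_eq hk,
    ← Submodule.spanRank_restrictScalars_eq (R := R) residue_surjective]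
  rfl

theorem minNumGenerators_eq_of_length_eq {N : Type u} [AddCommGroup N] [Module R N]
    [Module.Finite R M] [Module.Finite R N]
    (hM : Module.IsTorsionBySet R M (maximalIdeal R))
    (hN : Module.IsTorsionBySet R N (maximalIdeal R))
    (h : Module.length R M = Module.length R N) :
    minNumGenerators R M = minNumGenerators R N :=
  Cardinal.toENat_injOn minNumGenerators_lt_aleph0.le minNumGenerators_lt_aleph0.le (by
    rw [← length_eq_toENat_minNumGenerators hM, h, length_eq_toENat_minNumGenerators hN])

theorem isTorsionBySet_quotient_submoduleOf {R M : Type*} [CommRing R] [AddCommGroup M]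
    [Module R M] {I : Ideal R} {N P : Submodule R M} (h : I • P ≤ N) :
    Module.IsTorsionBySet R (P ⧸ N.submoduleOf P) I := by
  rintro z ⟨r, hr⟩
  obtain ⟨z, rfl⟩ := Submodule.mkQ_surjective _ z
  exact (Submodule.Quotient.mk_eq_zero _).mpr (h (Submodule.smul_mem_smul hr z.2))

theorem length_map_quotient_submoduleOf {R M N : Type*} [CommRing R] [AddCommGroup M]
    [Module R M] [AddCommGroup N] [Module R N] {f : M →ₗ[R] N} (hf : Function.Injective f)
    (I J : Submodule R M) :
    Module.length R (J.map f ⧸ (I.map f).submoduleOf (J.map f)) =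
      Module.length R (J ⧸ I.submoduleOf J) := by
  refine (Submodule.Quotient.equiv _ _ (Submodule.equivMapOfInjective f hf J) ?_).length_eq.symm
  ext ⟨z, hz⟩
  obtain ⟨y, hy, rfl⟩ := hz
  constructor
  · rintro ⟨w, hw, hwz⟩
    exact ⟨w, hw, congrArg Subtype.val hwz⟩
  · rintro ⟨w, hw, hwz⟩
    obtain rfl := hf hwz
    exact ⟨⟨w, hy⟩, hw, rfl⟩

end ResidueRank

section ConductorTransform

open IsLocalization (coeSubmodule)

variable {R : Type u} [CommRing R] [IsLocalRing R] {K : Type u} [Field K] [Algebra R K]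
  [IsFractionRing R K] [IsDedekindRing (integralClosure R K)] {x : R}

theorem maximalIdeal_mul_conductorIdeal_sup_span_le
    (hx : IsIdealReduction (Ideal.span {x}) (maximalIdeal R)) :
    maximalIdeal R * (conductorIdeal R K ⊔ Ideal.span {x}) ≤ Ideal.span {x} := by
  rw [Ideal.mul_sup]
  refine sup_le ?_ Ideal.mul_le_right
  rw [← IsFractionRing.coeSubmodule_le_coeSubmodule (K := K), IsLocalization.coeSubmodule_mul,
    hx.coeSubmodule_mul_conductorIdeal, ← IsLocalization.coeSubmodule_span_singleton,
    ← IsLocalization.coeSubmodule_mul]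
  exact IsLocalization.coeSubmodule_mono K Ideal.mul_le_left

theorem length_conductorTransform_quotient (hx0 : x ≠ 0)
    (hx : IsIdealReduction (Ideal.span {x}) (maximalIdeal R))
    (hC : conductorIdeal R K ≤ maximalIdeal R ^ 2) :
    Module.length R (Subalgebra.toSubmodule (conductorTransform R K x) ⧸
        (1 : Submodule R K).submoduleOf (Subalgebra.toSubmodule (conductorTransform R K x))) =
      Module.length R (↥(conductorIdeal R K ⊔ Ideal.span {x}) ⧸
        (Ideal.span {x}).submoduleOf (conductorIdeal R K ⊔ Ideal.span {x})) := by
  have hxK : algebraMap R K x ≠ 0 := by simpa using hx0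
  let f : R →ₗ[R] K := LinearMap.mulLeft R (algebraMap R K x)⁻¹ ∘ₗ Algebra.linearMap R K
  have hf : Function.Injective f :=
    (mul_right_injective₀ (inv_ne_zero hxK)).comp (IsFractionRing.injective R K)
  have hmap (I : Ideal R) :
      Submodule.map f I = Submodule.span R {(algebraMap R K x)⁻¹} * coeSubmodule K I := by
    rw [Submodule.map_comp, Submodule.span_singleton_mul]
    rfl
  have hspan : Submodule.map f (Ideal.span {x}) = 1 := by
    rw [hmap, IsLocalization.coeSubmodule_span_singleton, mul_comm,
      span_singleton_mul_span_singleton_inv hxK]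
  rw [← length_map_quotient_submoduleOf hf, Submodule.map_sup, hspan, hmap, sup_comm,
    ← toSubmodule_conductorTransform hx0 hx hC]

theorem isLocalRing_conductorTransform [Module.Finite R (conductorTransform R K x)] (hx0 : x ≠ 0)
    (hx : IsIdealReduction (Ideal.span {x}) (maximalIdeal R))
    (hC : conductorIdeal R K ≤ maximalIdeal R ^ 2) : IsLocalRing (conductorTransform R K x) := by
  refine isLocalRing_of_forall_sub_algebraMap_pow_mem (R := R) fun ⟨s, hs⟩ ↦ ?_
  rw [← Subalgebra.mem_toSubmodule, toSubmodule_conductorTransform hx0 hx hC] at hs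
  obtain ⟨_, hr, y, hy, rfl⟩ := Submodule.mem_sup.mp hs
  obtain ⟨r, rfl⟩ := Submodule.mem_one.mp hr
  obtain ⟨c, hc, hcy⟩ :=
    span_inv_mul_conductorIdeal_mul_self_le hx0 hx hC (Submodule.mul_mem_mul hy hy)
  refine ⟨r, 2, ?_⟩
  convert Ideal.mem_map_of_mem (algebraMap R (conductorTransform R K x))
    (Ideal.pow_le_self two_ne_zero (hC hc)) using 1
  refine Subtype.ext (Eq.trans ?_ hcy.symm)
  change (algebraMap R K r + y - algebraMap R K r) ^ 2 = y * y
  rw [add_sub_cancel_left, pow_two]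

variable [IsNoetherianRing R]

theorem finite_conductorTransform (hx0 : x ≠ 0)
    (hx : IsIdealReduction (Ideal.span {x}) (maximalIdeal R))
    (hC : conductorIdeal R K ≤ maximalIdeal R ^ 2) :
    Module.Finite R (conductorTransform R K x) := by
  have hfg (I : Ideal R) : (coeSubmodule K I).FG := (IsNoetherian.noetherian I).map _
  have hS : (Subalgebra.toSubmodule (conductorTransform R K x)).FG := by
    rw [toSubmodule_conductorTransform hx0 hx hC, ← IsLocalization.coeSubmodule_top]
    exact (hfg ⊤).sup ((Submodule.fg_span_singleton _).mul (hfg _))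
  exact Module.Finite.iff_fg.mpr hS

theorem IsCanonicalFractionalIdeal.coeSubmodule_div_conductorTransform [IsDomain R]
    [Ring.DimensionLEOne R] [IsPrincipalIdealRing (integralClosure R K)]
    [Module.Finite R (integralClosure R K)] {ω : Ideal R}
    (hω : IsCanonicalFractionalIdeal (coeSubmodule K ω)) (hx0 : x ≠ 0)
    (hx : IsIdealReduction (Ideal.span {x}) (maximalIdeal R))
    (hC : conductorIdeal R K ≤ maximalIdeal R ^ 2) :
    coeSubmodule K ω / Subalgebra.toSubmodule (conductorTransform R K x) =
      coeSubmodule K (ω ⊓ idealIntegralClosure (maximalIdeal R * ω)) := by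
  have hxK : algebraMap R K x ≠ 0 := by simpa using hx0
  rw [toSubmodule_conductorTransform hx0 hx hC, submodule_div_sup, submodule_div_one,
    mul_comm (Submodule.span R _), ← submodule_div_div, hω.div_coeSubmodule_conductorIdeal,
    submodule_div_span_singleton_inv hxK, mul_left_comm,
    coeSubmodule_inf_idealIntegralClosure (integralClosure R K), IsLocalization.coeSubmodule_mul,
    mul_comm (coeSubmodule K (maximalIdeal R)), mul_assoc, ← hx.coeSubmodule_mul_eq,
    IsLocalization.coeSubmodule_span_singleton]

end ConductorTransform

section Main

open IsLocalization (coeSubmodule)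

variable {R : Type u} [CommRing R] [IsDomain R]

theorem IsIdealReduction.ne_zero {I : Ideal R} {x : R} (hx : IsIdealReduction (Ideal.span {x}) I)
    (hI : I ≠ ⊥) : x ≠ 0 := by
  rintro rfl
  obtain ⟨-, n, hn⟩ := hx
  rw [Ideal.span_singleton_zero, ← Ideal.zero_eq_bot, zero_mul] at hn
  exact hI (eq_zero_of_pow_eq_zero hn.symm)

variable [IsLocalRing R] [IsNoetherianRing R] [Ring.DimensionLEOne R] {K : Type u}
  [Field K] [Algebra R K] [IsFractionRing R K] [Module.Finite R (integralClosure R K)]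
  [IsPrincipalIdealRing (integralClosure R K)] {x : R} {ω : Ideal R}

theorem length_conductor_sup_span_quotient_eq_length_canonical_quotient (hx0 : x ≠ 0)
    (hx : IsIdealReduction (Ideal.span {x}) (maximalIdeal R))
    (hC : conductorIdeal R K ≤ maximalIdeal R ^ 2)
    (hω : IsCanonicalFractionalIdeal (coeSubmodule K ω)) :
    Module.length R (↥(conductorIdeal R K ⊔ Ideal.span {x}) ⧸
        (Ideal.span {x}).submoduleOf (conductorIdeal R K ⊔ Ideal.span {x})) =
      Module.length R
        (ω ⧸ (ω ⊓ idealIntegralClosure (maximalIdeal R * ω)).submoduleOf ω) := by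
  have hfg : (Subalgebra.toSubmodule (conductorTransform R K x)).FG :=
    Module.Finite.iff_fg.mp (finite_conductorTransform hx0 hx hC)
  have hduality := hω.length_quotient_eq_length_div_quotient_div
    (Submodule.one_le.mpr (conductorTransform R K x).one_mem) one_ne_zero hfg
  rw [submodule_div_one, hω.coeSubmodule_div_conductorTransform hx0 hx hC,
    length_conductorTransform_quotient hx0 hx hC] at hduality
  exact hduality.trans (length_map_quotient_submoduleOf (f := Algebra.linearMap R K)
    (IsFractionRing.injective R K) _ _)

theorem reducedType_eq_minNumGenerators {k : Type v} [Field k] [Algebra k R]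
    (hk : Function.Surjective (algebraMap k (ResidueField R))) (hx0 : x ≠ 0)
    (hx : IsIdealReduction (Ideal.span {x}) (maximalIdeal R))
    (hC : conductorIdeal R K ≤ maximalIdeal R ^ 2)
    (hω : IsCanonicalFractionalIdeal (coeSubmodule K ω)) :
    reducedType k R K x =
      minNumGenerators R
        (ω ⧸ (ω ⊓ idealIntegralClosure (maximalIdeal R * ω)).submoduleOf ω) := by
  have hCx : maximalIdeal R • (conductorIdeal R K ⊔ Ideal.span {x}) ≤ Ideal.span {x} :=
    maximalIdeal_mul_conductorIdeal_sup_span_le hx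
  have hω' : maximalIdeal R • ω ≤ ω ⊓ idealIntegralClosure (maximalIdeal R * ω) :=
    le_inf Ideal.mul_le_right (le_idealIntegralClosure _)
  rw [reducedType, rank_eq_minNumGenerators hk (isTorsionBySet_quotient_submoduleOf hCx)]
  exact minNumGenerators_eq_of_length_eq (isTorsionBySet_quotient_submoduleOf hCx)
    (isTorsionBySet_quotient_submoduleOf hω')
    (length_conductor_sup_span_quotient_eq_length_canonical_quotient hx0 hx hC hω)

end Main

theorem mainTheorem7_general
    {k : Type v} [Field k]
    {R : Type u} [CommRing R] [IsDomain R] [IsLocalRing R] [IsNoetherianRing R] [Algebra k R]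
    (hk : Function.Surjective (algebraMap k (ResidueField R)))
    (hdim : ringKrullDim R = 1)
    {K : Type u} [Field K] [Algebra R K] [IsFractionRing R K]
    [Module.Finite R (integralClosure R K)]
    (hC : conductorIdeal R K ≤ maximalIdeal R ^ 2)
    (x : R) (hx : IsIdealReduction (Ideal.span {x}) (maximalIdeal R))
    (ω : Ideal R) (hω : IsCanonicalModule R ω) :
    (∃ (_ : IsLocalRing (conductorTransform R K x))
      (W : Submodule (conductorTransform R K x) K),
        (W : Set K) =
          algebraMap R K '' (ω ⊓ idealIntegralClosure (maximalIdeal R * ω) : Ideal R) ∧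
        IsCanonicalModule (conductorTransform R K x) W) ∧
    reducedType k R K x =
      minNumGenerators R
        (ω ⧸ (ω ⊓ idealIntegralClosure (maximalIdeal R * ω)).submoduleOf ω) := by
  have := dimensionLEOne_of_ringKrullDim_eq_one hdim
  have := isIntegrallyClosed_integralClosure R K
  have := isPrincipalIdealRing_of_finite R (integralClosure R K)
  have hx0 : x ≠ 0 := hx.ne_zero
    (isField_iff_maximalIdeal_eq.not.mp (not_isField_of_ringKrullDim_eq_one hdim))
  have hΩ := hω.isCanonicalFractionalIdeal_coeSubmodule hdim K
  have := finite_conductorTransform hx0 hx hC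
  have := isFractionRing_subalgebra (conductorTransform R K x)
  have := IsNoetherianRing.of_finite R (conductorTransform R K x)
  have hlocal := isLocalRing_conductorTransform hx0 hx hC
  exact ⟨⟨hlocal, divSubalgebra _ _,
    congrArg SetLike.coe (hΩ.coeSubmodule_div_conductorTransform hx0 hx hC),
    (hΩ.divSubalgebra _).isCanonicalModule (ringKrullDim_eq_one_of_isIntegral _ hdim)⟩,
    reducedType_eq_minNumGenerators hk hx0 hx hC hΩ⟩

theorem mainTheorem7
    {k : Type v} [Field k] [IsAlgClosed k] [CharZero k]
    {R : Type u} [CommRing R] [IsDomain R] [IsLocalRing R] [IsNoetherianRing R]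
    [IsAdicComplete (maximalIdeal R) R] [Algebra k R]
    (hk : Function.Bijective (algebraMap k (ResidueField R)))
    (hdim : ringKrullDim R = 1)
    {K : Type u} [Field K] [Algebra R K] [IsFractionRing R K]
    (hC : conductorIdeal R K ≤ maximalIdeal R ^ 2)
    (x : R) (hx : IsIdealReduction (Ideal.span {x}) (maximalIdeal R))
    (ω : Ideal R) (hω : IsCanonicalModule R ω) :
    (∃ (_ : IsLocalRing (conductorTransform R K x))
      (W : Submodule (conductorTransform R K x) K),
        (W : Set K) =
          algebraMap R K '' (ω ⊓ idealIntegralClosure (maximalIdeal R * ω) : Ideal R) ∧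
        IsCanonicalModule (conductorTransform R K x) W) ∧
    reducedType k R K x =
      minNumGenerators R
        (ω ⧸ (ω ⊓ idealIntegralClosure (maximalIdeal R * ω)).submoduleOf ω) :=
  have := dimensionLEOne_of_ringKrullDim_eq_one hdim
  have := finite_integralClosure (not_isField_of_ringKrullDim_eq_one hdim) K
  mainTheorem7_general hk.2 hdim hC x hx ω hω
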